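/- **Proposition A.5.** A partition word of length $2k$ is a word with $k$ distinct letters, each occurring exactly twice, such that the first occurrences of the letters are in alphabetic order (for $k=0$ it is the empty word). The height $h(w)$ of a partition word $w$ is the number of its encapsulated partition subwords, that is, of substrings of the form $x w_1 x$ of $w$, where $x$ is a single letter and $w_1$ is a partition word or the empty word. There is exactly one symmetric probability measure $\gamma_M$ on $\mathbb{R}$ that has finite even moments given by $$\int x^{2k}\,\gamma_M(dx)=\sum_{w:\,|w|=2k}2^{h(w)},\qquad k=0,1,2,\dots,$$ where the sum runs over all partition words $w$ of length $2k$, and it is the free convolution $$\gamma_M=\gamma_0\boxplus\gamma_1$$ of the semicircle law $\gamma_0(dx)=\frac{1}{2\pi}\sqrt{4-x^2}\,\mathbf 1_{|x|\le 2}\,dx$ and the standard normal law $\gamma_1(dx)=\frac{1}{\sqrt{2\pi}}e^{-x^2/2}\,dx$. Here, for probability measures $\mu,\nu$ on $\mathbb{R}$, the free convolution $\mu\boxplus\nu$ is the unique probability measure with $\varphi_{\mu\boxplus\nu}=\varphi_\mu+\varphi_\nu$ on some truncated cone $\Gamma_{\alpha,\beta}=\{x+iy: y>\beta,\ |x|<\alpha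 y\}$, $\alpha,\beta>0$, where $\varphi_\mu(z)=F_\mu^{-1}(z)-z$ is the Voiculescu transform, $F_\mu(z)=\bigl(\int (z-x)^{-1}\mu(dx)\bigr)^{-1}$, and $F_\mu^{-1}$ is the holomorphic right inverse of $F_\mu$ on the cone with values in the upper half-plane and $F_\mu^{-1}(z)=z+o(|z|)$ as $z\to\infty$ in the cone. -/

import Mathlib

open MeasureTheory ProbabilityTheory Filter Topology

/-! ### Partition words -/

namespace PartitionWord

/-- Given a word `w` of length `n` with letters in the ordered alphabet `Fin k`, the letters of `w`
at the positions in `I` form a partition word (possibly the empty one): every letter that occurs in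
`I` occurs there exactly twice, and the first occurrences of the letters are in alphabetic order,
that is, every occurrence of a letter is preceded by an occurrence of each smaller letter that is
used in `I`. -/
def IsPartitionOn {n k : ℕ} (w : Fin n → Fin k) (I : Finset (Fin n)) : Prop :=
  (∀ l ∈ I, (I.filter fun m => w m = w l).card = 2) ∧
    ∀ l ∈ I, ∀ m ∈ I, w l < w m → ∃ l' ∈ I, l' < m ∧ w l' = w l

instance {n k : ℕ} (w : Fin n → Fin k) (I : Finset (Fin n)) : Decidable (IsPartitionOn w I) := by
  unfold IsPartitionOn
  infer_instance

/-- The partition words of length `2 * k`, with letters in `Fin k`. As each letter that is used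
occurs exactly twice, each of the `k` letters is used. -/
def words (k : ℕ) : Finset (Fin (2 * k) → Fin k) :=
  Finset.univ.filter fun w => IsPartitionOn w Finset.univ

/-- The height of `w`: the number of encapsulated partition subwords, that is, of substrings
`x w₁ x` of `w` (counted by the positions `i < j` of their two end letters `x`), with `x` a letter
and `w₁` a partition word or the empty word. -/
def height {n k : ℕ} (w : Fin n → Fin k) : ℕ :=
  (Finset.univ.filter fun p : Fin n × Fin n =>
    p.1 < p.2 ∧ w p.1 = w p.2 ∧ IsPartitionOn w (Finset.Ioo p.1 p.2)).card

end PartitionWord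

/-! ### Free convolution of probability measures on the line -/

namespace FreeConv

/-- The Cauchy transform `G_μ(z) = ∫ (z - x)⁻¹ μ(dx)`. -/
noncomputable def cauchyTransform (μ : Measure ℝ) (z : ℂ) : ℂ :=
  ∫ x : ℝ, (z - (x : ℂ))⁻¹ ∂μ

/-- The reciprocal Cauchy transform `F_μ = 1 / G_μ`. -/
noncomputable def reciprocalCauchyTransform (μ : Measure ℝ) (z : ℂ) : ℂ :=
  (cauchyTransform μ z)⁻¹

/-- The truncated cone `Γ_{α,β} = {x + i y : y > β, |x| < α y}`. -/
def cone (α β : ℝ) : Set ℂ :=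
  {z | β < z.im ∧ |z.re| < α * z.im}

/-- `φ` is the Voiculescu transform of `μ` on `Γ_{α,β}`: `φ(z) = F_μ⁻¹(z) - z`, where `F_μ⁻¹` is
the right inverse of `F_μ` with values in the upper half-plane that is holomorphic on the cone and
satisfies `F_μ⁻¹(z) = z + o(|z|)` as `z → ∞` in the cone. -/
structure IsVoiculescuTransform (μ : Measure ℝ) (α β : ℝ) (φ : ℂ → ℂ) : Prop where
  differentiableOn : DifferentiableOn ℂ φ (cone α β)
  im_pos : ∀ z ∈ cone α β, 0 < (z + φ z).im
  right_inverse : ∀ z ∈ cone α β, reciprocalCauchyTransform μ (z + φ z) = z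
  tendsto : Tendsto (fun z => φ z / z) (Bornology.cobounded ℂ ⊓ 𝓟 (cone α β)) (𝓝 0)

/-- `ρ` is the free convolution `μ ⊞ ν`: the Voiculescu transforms satisfy `φ_ρ = φ_μ + φ_ν` on a
truncated cone on which they are all defined. -/
def IsFreeConvolution (μ ν ρ : Measure ℝ) : Prop :=
  ∃ α β : ℝ, 0 < α ∧ 0 < β ∧ ∃ φμ φν : ℂ → ℂ,
    IsVoiculescuTransform μ α β φμ ∧ IsVoiculescuTransform ν α β φν ∧
      IsVoiculescuTransform ρ α β (fun z => φμ z + φν z)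

/-- The standard semicircle law, with density `√(4 - x²) / (2π)` on `[-2, 2]`. -/
noncomputable def semicircle : Measure ℝ :=
  (volume.restrict (Set.Icc (-2 : ℝ) 2)).withDensity fun x =>
    ENNReal.ofReal (Real.sqrt (4 - x ^ 2) / (2 * Real.pi))

/-- `ρ` is symmetric: invariant under `x ↦ -x`. -/
def IsSymmetric (ρ : Measure ℝ) : Prop :=
  ρ.map (fun x => -x) = ρ

/-- The even moments of `ρ` exist and `m_{2k}(ρ) = ∑_{|w| = 2k} 2 ^ h(w)` for all `k`, where `w`
runs over the partition words and `h` is the height. -/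
def HasHeightMoments (ρ : Measure ℝ) : Prop :=
  ∀ k : ℕ, Integrable (fun x : ℝ => x ^ (2 * k)) ρ ∧
    ∫ x : ℝ, x ^ (2 * k) ∂ρ = ∑ w ∈ PartitionWord.words k, (2 : ℝ) ^ PartitionWord.height w

end FreeConv

/-!
The Voiculescu transform of the semicircle law is `z ↦ 1 / z`. Hence its free convolution `ρ` with a
law `ν` of finite variance is characterized by Pastur's equation `G_ρ(z) = G_ν(z - G_ρ(z))`, which
is solved on `{Im z > 1}` by iterating the contraction `g ↦ G_ν(z - g)`; the iterates stay among the
Cauchy transforms, as one sees for `ν` and `g` with finite support from the Schur complement formula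
and in general by approximation.

Expanding Pastur's equation for the transforms of `x ^ b dν(x)` at infinity yields a recursion for
coefficients `d b n` with `d b 0 = ∫ x ^ b dν(x)` and `d 0 n = ∫ x ^ n dρ(x)`. For the standard
normal law, `d b n` counts the pairings of `b + n` points with weight `2` for each chord that starts
among the last `n` points and is not crossed by any other chord: in the recursion, the first of
these `n` points either gives up its weight, or starts an uncrossed chord, which separates the
points that it encloses from the others. A partition word is a pairing of its positions, and its
encapsulated partition subwords are the uncrossed chords.

The `2k`-th moment is at most `4 ^ k` times the Gaussian one, so `ρ` has exponential moments and is
determined among the symmetric measures by its even moments.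
-/

open Bornology
open scoped NNReal

namespace FreeConv

/-! ### The Cauchy transform -/

lemma sub_ofReal_ne_zero {z : ℂ} (hz : 0 < z.im) (x : ℝ) : z - x ≠ 0 := fun h =>
  hz.ne' (by simpa using congrArg Complex.im h)

lemma im_le_norm_sub_ofReal (z : ℂ) (x : ℝ) : z.im ≤ ‖z - x‖ := by
  simpa using (le_abs_self _).trans (Complex.abs_im_le_norm (z - x))

lemma norm_inv_sub_ofReal_le {z : ℂ} (hz : 0 < z.im) (x : ℝ) : ‖(z - x)⁻¹‖ ≤ z.im⁻¹ := by
  rw [norm_inv]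
  exact inv_anti₀ hz (im_le_norm_sub_ofReal z x)

lemma continuous_inv_sub_ofReal {z : ℂ} (hz : 0 < z.im) : Continuous fun x : ℝ => (z - x)⁻¹ :=
  (by fun_prop : Continuous fun x : ℝ => z - x).inv₀ (sub_ofReal_ne_zero hz)

section FiniteMeasure

variable (μ : Measure ℝ) [IsFiniteMeasure μ]

lemma integrable_inv_sub_ofReal {z : ℂ} (hz : 0 < z.im) :
    Integrable (fun x : ℝ => (z - x)⁻¹) μ :=
  .of_bound (continuous_inv_sub_ofReal hz).aestronglyMeasurable z.im⁻¹
    (.of_forall (norm_inv_sub_ofReal_le hz))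

lemma im_cauchyTransform {z : ℂ} (hz : 0 < z.im) :
    (cauchyTransform μ z).im = ∫ x : ℝ, ((z - x)⁻¹).im ∂μ :=
  (integral_im (integrable_inv_sub_ofReal μ hz)).symm

lemma im_cauchyTransform_nonpos {z : ℂ} (hz : 0 < z.im) : (cauchyTransform μ z).im ≤ 0 := by
  rw [im_cauchyTransform μ hz]
  refine integral_nonpos fun x => ?_
  simp only [Complex.inv_im, Complex.sub_im, Complex.ofReal_im, sub_zero, Pi.zero_apply]
  exact div_nonpos_of_nonpos_of_nonneg (neg_nonpos.2 hz.le) (Complex.normSq_nonneg _)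

lemma im_le_im_sub_cauchyTransform {z : ℂ} (hz : 0 < z.im) :
    z.im ≤ (z - cauchyTransform μ z).im := by
  simpa using im_cauchyTransform_nonpos μ hz

lemma cauchyTransform_sub_cauchyTransform {z w : ℂ} (hz : 0 < z.im) (hw : 0 < w.im) :
    cauchyTransform μ z - cauchyTransform μ w =
      (w - z) * ∫ x : ℝ, (z - x)⁻¹ * (w - x)⁻¹ ∂μ := by
  rw [cauchyTransform, cauchyTransform, ← integral_sub (integrable_inv_sub_ofReal μ hz)
    (integrable_inv_sub_ofReal μ hw), ← integral_const_mul]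
  congr with x
  rw [inv_sub_inv (sub_ofReal_ne_zero hz x) (sub_ofReal_ne_zero hw x), sub_sub_sub_cancel_right,
    div_eq_mul_inv, mul_inv]

lemma differentiableOn_cauchyTransform :
    DifferentiableOn ℂ (cauchyTransform μ) {z | 0 < z.im} := by
  have h : cauchyTransform μ = -resolventTransform μ := by
    ext z
    simp [cauchyTransform, resolventTransform_apply, resolvent, ← integral_neg, ← inv_neg]
  rw [h]
  refine fun z (hz : 0 < z.im) =>
    (hasDerivAt_resolventTransform z ?_).neg.differentiableAt.differentiableWithinAt
  rintro ⟨x, -, rfl⟩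
  simp at hz

end FiniteMeasure

section ProbabilityMeasure

variable (μ : Measure ℝ) [IsProbabilityMeasure μ]

lemma norm_cauchyTransform_le {z : ℂ} (hz : 0 < z.im) : ‖cauchyTransform μ z‖ ≤ z.im⁻¹ := by
  simpa [cauchyTransform] using
    norm_integral_le_of_norm_le_const (μ := μ) (.of_forall (norm_inv_sub_ofReal_le hz))

lemma norm_cauchyTransform_sub_cauchyTransform_le {z w : ℂ} (hz : 0 < z.im) (hw : 0 < w.im) :
    ‖cauchyTransform μ z - cauchyTransform μ w‖ ≤ ‖z - w‖ * (z.im⁻¹ * w.im⁻¹) := by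
  rw [cauchyTransform_sub_cauchyTransform μ hz hw, norm_mul, norm_sub_rev w z]
  gcongr
  have hbound (x : ℝ) : ‖(z - x)⁻¹ * (w - x)⁻¹‖ ≤ z.im⁻¹ * w.im⁻¹ := by
    rw [norm_mul]
    gcongr <;> exact norm_inv_sub_ofReal_le ‹_› x
  simpa using norm_integral_le_of_norm_le_const (μ := μ) (.of_forall hbound)

/-- On `{Im > 1}` the Cauchy transform is a strict contraction. -/
lemma eq_of_eq_cauchyTransform_sub {v u u' : ℂ}
    (h : u = cauchyTransform μ (v - u)) (h' : u' = cauchyTransform μ (v - u'))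
    (hu : 1 < (v - u).im) (hu' : 1 < (v - u').im) : u = u' := by
  by_contra hne
  have hle := norm_cauchyTransform_sub_cauchyTransform_le μ (zero_lt_one.trans hu)
    (zero_lt_one.trans hu')
  rw [← h, ← h', sub_sub_sub_cancel_left, norm_sub_rev u' u] at hle
  have hlt : (v - u).im⁻¹ * (v - u').im⁻¹ < 1 :=
    mul_lt_one_of_nonneg_of_lt_one_left (by positivity) (inv_lt_one_of_one_lt₀ hu)
      (inv_lt_one_of_one_lt₀ hu').le
  have hpos : 0 < ‖u - u'‖ := norm_pos_iff.2 (sub_ne_zero.2 hne)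
  nlinarith

lemma tendsto_mul_cauchyTransform {ι : Type*} {l : Filter ι} [l.IsCountablyGenerated] {w : ι → ℂ}
    {C : ℝ} (hw : Tendsto w l (cobounded ℂ)) (hpos : ∀ᶠ i in l, 0 < (w i).im)
    (hcone : ∀ᶠ i in l, ‖w i‖ ≤ C * (w i).im) :
    Tendsto (fun i => w i * cauchyTransform μ (w i)) l (𝓝 1) := by
  have hone : (1 : ℂ) = ∫ _ : ℝ, (1 : ℂ) ∂μ := by simp
  simp only [cauchyTransform, ← integral_const_mul]
  rw [hone]
  refine tendsto_integral_filter_of_dominated_convergence (fun _ => C) ?_ ?_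
    (integrable_const _) (.of_forall fun x => ?_)
  · filter_upwards [hpos] with i hi
    exact (continuous_const.mul (continuous_inv_sub_ofReal hi)).aestronglyMeasurable
  · filter_upwards [hpos, hcone] with i hi hCi
    refine .of_forall fun x => ?_
    calc ‖w i * (w i - x)⁻¹‖ ≤ (C * (w i).im) * (w i).im⁻¹ := by
          rw [norm_mul]
          gcongr
          · exact (norm_nonneg _).trans hCi
          · exact norm_inv_sub_ofReal_le hi x
      _ = C := mul_inv_cancel_right₀ hi.ne' C
  · have hinv : Tendsto (fun i => (w i - x)⁻¹) l (𝓝 0) :=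
      tendsto_inv₀_cobounded.comp ((tendsto_sub_const_cobounded (x : ℂ)).comp hw)
    have hlim : Tendsto (fun i => 1 + x * (w i - x)⁻¹) l (𝓝 1) := by
      simpa using (hinv.const_mul (x : ℂ)).const_add 1
    refine hlim.congr' ?_
    filter_upwards [hpos] with i hi
    have := sub_ofReal_ne_zero hi x
    field_simp
    ring

lemma tendsto_mul_I_mul_cauchyTransform_sub {u : ℝ → ℂ}
    (hu : ∀ᶠ y in atTop, ‖u y‖ ≤ 1 ∧ (u y).im ≤ 0) :
    Tendsto (fun y : ℝ => y * Complex.I * cauchyTransform μ (y * Complex.I - u y)) atTop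
      (𝓝 1) := by
  have him : ∀ᶠ y : ℝ in atTop, y ≤ (y * Complex.I - u y).im := by
    filter_upwards [hu] with y hy
    simpa using hy.2
  have hmain : Tendsto (fun y : ℝ => (y * Complex.I - u y) *
      cauchyTransform μ (y * Complex.I - u y)) atTop (𝓝 1) := by
    refine tendsto_mul_cauchyTransform μ (C := 2) ?_ ?_ ?_
    · rw [← tendsto_norm_atTop_iff_cobounded]
      refine tendsto_atTop_mono' _ ?_ tendsto_id
      filter_upwards [him] with y hy
      exact hy.trans ((le_abs_self _).trans (Complex.abs_im_le_norm _))
    · filter_upwards [him, eventually_gt_atTop 0] with y hy hy0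
      exact hy0.trans_le hy
    · filter_upwards [him, hu, eventually_ge_atTop 1] with y hy huy hy1
      calc ‖y * Complex.I - u y‖ ≤ ‖y * Complex.I‖ + ‖u y‖ := norm_sub_le _ _
        _ = y + ‖u y‖ := by simp [abs_of_nonneg (zero_le_one.trans hy1)]
        _ ≤ 2 * (y * Complex.I - u y).im := by linarith [huy.1]
  have herror : Tendsto (fun y : ℝ => u y * cauchyTransform μ (y * Complex.I - u y)) atTop
      (𝓝 0) := by
    refine squeeze_zero_norm' ?_ tendsto_inv_atTop_zero
    filter_upwards [him, hu, eventually_gt_atTop 0] with y hy huy hy0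
    calc ‖u y * cauchyTransform μ (y * Complex.I - u y)‖ ≤ 1 * y⁻¹ := by
          rw [norm_mul]
          gcongr
          · exact huy.1
          · exact (norm_cauchyTransform_le μ (hy0.trans_le hy)).trans (inv_anti₀ hy0 hy)
      _ = y⁻¹ := one_mul _
  simpa [← add_mul] using hmain.add herror

end ProbabilityMeasure

/-! ### Stieltjes inversion -/

lemma cauchyMeasure_zero_eq_map {y : ℝ≥0} (hy : y ≠ 0) :
    cauchyMeasure 0 y = (cauchyMeasure 0 1).map fun x : ℝ => y * x := by
  have hy' : (y : ℝ) ≠ 0 := by exact_mod_cast hy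
  have hpdf (x : ℝ) : ENNReal.ofReal |(y : ℝ)| * cauchyPDF 0 y (y * x) = cauchyPDF 0 1 x := by
    rw [cauchyPDF, cauchyPDF, ← ENNReal.ofReal_mul (abs_nonneg _), cauchyPDFReal_def',
      cauchyPDFReal_def']
    congr 1
    simp [mul_div_cancel_left₀ x hy']
    field_simp
  ext s hs
  have hscale : MeasurableSet ((fun x : ℝ => y * x) ⁻¹' s) := measurable_const_mul _ hs
  rw [Measure.map_apply (measurable_const_mul _) hs, cauchyMeasure_of_scale_ne_zero 0 hy,
    cauchyMeasure_of_scale_ne_zero 0 one_ne_zero, withDensity_apply _ hs,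
    withDensity_apply _ hscale,
    ← Set.image_preimage_eq s (mul_left_surjective₀ hy'),
    lintegral_image_eq_lintegral_abs_deriv_mul hscale
      (fun x _ => (hasDerivAt_const_mul (y : ℝ)).hasDerivWithinAt)
      (mul_right_injective₀ hy').injOn, Set.image_preimage_eq s (mul_left_surjective₀ hy')]
  simp only [hpdf]

lemma cauchyPDFReal_eq_im_inv_sub {y : ℝ≥0} (hy : y ≠ 0) (x t : ℝ) :
    cauchyPDFReal x y t = -(((t : ℂ) + y * Complex.I - x)⁻¹).im / Real.pi := by
  have hy' : (y : ℝ) ≠ 0 := by exact_mod_cast hy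
  simp [cauchyPDFReal_def, Complex.inv_im, Complex.normSq_apply]
  field_simp

lemma conv_cauchyMeasure (μ : Measure ℝ) [IsFiniteMeasure μ] {y : ℝ≥0} (hy : y ≠ 0) :
    μ ∗ cauchyMeasure 0 y = volume.withDensity fun t : ℝ =>
      ENNReal.ofReal (-(cauchyTransform μ (t + y * Complex.I)).im / Real.pi) := by
  have hmeas : Measurable fun p : ℝ × ℝ => cauchyPDF p.1 y p.2 := by
    simp only [cauchyPDF, cauchyPDFReal_def]
    fun_prop
  have htranslate (s : Set ℝ) (hs : MeasurableSet s) (x : ℝ) :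
      ∫⁻ t, s.indicator 1 (x + t) ∂cauchyMeasure 0 y = ∫⁻ t in s, cauchyPDF x y t := by
    rw [cauchyMeasure_of_scale_ne_zero 0 hy, lintegral_withDensity_eq_lintegral_mul _
      (measurable_cauchyPDF 0 y) (g := fun t => s.indicator 1 (x + t))
      ((measurable_one.indicator hs).comp (measurable_const_add x)),
      ← lintegral_sub_right_eq_self _ x, ← lintegral_indicator hs]
    refine lintegral_congr fun t => ?_
    by_cases ht : t ∈ s <;> simp [ht, cauchyPDF, cauchyPDFReal_def]
  have hdensity (t : ℝ) : ∫⁻ x, cauchyPDF x y t ∂μ =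
      ENNReal.ofReal (-(cauchyTransform μ (t + y * Complex.I)).im / Real.pi) := by
    have him : 0 < ((t : ℂ) + y * Complex.I).im := by simpa using pos_iff_ne_zero.2 hy
    have hint : Integrable (fun x => cauchyPDFReal x y t) μ := by
      simp only [cauchyPDFReal_eq_im_inv_sub hy]
      exact ((integrable_inv_sub_ofReal μ him).im.neg).div_const _
    simp only [cauchyPDF]
    rw [← ofReal_integral_eq_lintegral_ofReal hint (.of_forall fun x => (cauchyPDF_pos x hy t).le),
      im_cauchyTransform μ him, ← integral_neg, ← integral_div]
    simp only [cauchyPDFReal_eq_im_inv_sub hy]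
  ext s hs
  rw [← lintegral_indicator_one hs, Measure.lintegral_conv (measurable_one.indicator hs),
    withDensity_apply _ hs]
  simp only [htranslate s hs]
  rw [lintegral_lintegral_swap hmeas.aemeasurable]
  exact lintegral_congr hdensity

/-- The characteristic function of a Cauchy law of small scale does not vanish at a given point, so
that the convolution can be undone. -/
lemma eq_of_conv_cauchyMeasure_eq {μ ν : Measure ℝ} [IsFiniteMeasure μ] [IsFiniteMeasure ν]
    (h : ∀ y : ℝ≥0, y ≠ 0 → μ ∗ cauchyMeasure 0 y = ν ∗ cauchyMeasure 0 y) : μ = ν := by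
  refine Measure.ext_of_charFun (funext fun t => ?_)
  have hlim : Tendsto (fun y : ℝ≥0 => charFun (cauchyMeasure 0 1) (y * t)) (𝓝[≠] 0) (𝓝 1) := by
    have hcont : Continuous fun y : ℝ≥0 => charFun (cauchyMeasure 0 1) (y * t) :=
      continuous_charFun.comp (by fun_prop)
    simpa using (hcont.tendsto 0).mono_left nhdsWithin_le_nhds
  obtain ⟨y, hne, hy⟩ := ((hlim.eventually_ne one_ne_zero).and self_mem_nhdsWithin).exists
  have heq := congrArg (fun ρ => charFun ρ t) (h y hy)
  simp only [charFun_conv, cauchyMeasure_zero_eq_map hy, charFun_map_mul] at heq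
  exact mul_right_cancel₀ hne heq

theorem ext_of_cauchyTransform {μ ν : Measure ℝ} [IsFiniteMeasure μ] [IsFiniteMeasure ν]
    (h : ∀ z : ℂ, 0 < z.im → cauchyTransform μ z = cauchyTransform ν z) : μ = ν := by
  refine eq_of_conv_cauchyMeasure_eq fun y hy => ?_
  rw [conv_cauchyMeasure μ hy, conv_cauchyMeasure ν hy]
  congr with t
  rw [h _ (by simpa using pos_iff_ne_zero.2 hy)]

theorem ext_of_frequently_cauchyTransform_eq {μ ν : Measure ℝ} [IsFiniteMeasure μ]
    [IsFiniteMeasure ν] {z₀ : ℂ} (hz₀ : 0 < z₀.im)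
    (h : ∃ᶠ z in 𝓝[≠] z₀, cauchyTransform μ z = cauchyTransform ν z) : μ = ν := by
  have hopen : IsOpen {z : ℂ | 0 < z.im} := isOpen_lt continuous_const Complex.continuous_im
  exact ext_of_cauchyTransform fun z hz =>
    ((differentiableOn_cauchyTransform μ).analyticOnNhd hopen).eqOn_of_preconnected_of_frequently_eq
      ((differentiableOn_cauchyTransform ν).analyticOnNhd hopen)
      (convex_halfSpace_im_gt 0).isPreconnected hz₀ h hz

/-! ### Weak limits and composition of Cauchy transforms -/

lemma one_sub_re_mul_I_mul_inv_sub {y : ℝ} (hy : 0 < y) (x : ℝ) :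
    (1 - y * Complex.I * (y * Complex.I - x)⁻¹).re = x ^ 2 / (x ^ 2 + y ^ 2) := by
  have : x ^ 2 + y ^ 2 ≠ 0 := by positivity
  simp [Complex.inv_im, Complex.normSq_apply]
  field_simp
  ring

lemma measure_norm_gt_le (μ : Measure ℝ) [IsProbabilityMeasure μ] {y : ℝ} (hy : 0 < y) :
    μ {x | y < ‖x‖} ≤
      ENNReal.ofReal (2 * (1 - y * Complex.I * cauchyTransform μ (y * Complex.I)).re) := by
  have hint : Integrable (fun x : ℝ => 1 - y * Complex.I * (y * Complex.I - x)⁻¹) μ :=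
    (integrable_const 1).sub ((integrable_inv_sub_ofReal μ (by simpa using hy)).const_mul _)
  have hre : (1 - y * Complex.I * cauchyTransform μ (y * Complex.I)).re =
      ∫ x, x ^ 2 / (x ^ 2 + y ^ 2) ∂μ := by
    simp only [← one_sub_re_mul_I_mul_inv_sub hy]
    have h := integral_re hint
    rw [integral_sub (integrable_const 1) ((integrable_inv_sub_ofReal μ (by simpa)).const_mul _),
      integral_const_mul] at h
    simpa [cauchyTransform] using h.symm
  have hmarkov : 1 / 2 * μ.real {x | 1 / 2 ≤ x ^ 2 / (x ^ 2 + y ^ 2)} ≤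
      ∫ x, x ^ 2 / (x ^ 2 + y ^ 2) ∂μ :=
    mul_meas_ge_le_integral_of_nonneg (.of_forall fun x => by positivity)
      (hint.re.congr (.of_forall fun x => one_sub_re_mul_I_mul_inv_sub hy x)) _
  have hsub : {x : ℝ | y < ‖x‖} ⊆ {x | 1 / 2 ≤ x ^ 2 / (x ^ 2 + y ^ 2)} := fun x hx => by
    have hyx : y ^ 2 < x ^ 2 := sq_lt_sq.2 (by rwa [abs_of_pos hy])
    rw [Set.mem_ofPred_eq, le_div_iff₀ (by positivity)]
    linarith
  rw [hre, ← ofReal_measureReal]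
  refine ENNReal.ofReal_le_ofReal ((measureReal_mono hsub).trans ?_)
  linarith

lemma isTightMeasureSet_range_of_tendsto_cauchyTransform {μ : ℕ → Measure ℝ}
    [∀ n, IsProbabilityMeasure (μ n)] {Φ : ℂ → ℂ}
    (h : ∀ z : ℂ, 1 < z.im → Tendsto (fun n => cauchyTransform (μ n) z) atTop (𝓝 (Φ z)))
    (hΦ : Tendsto (fun y : ℝ => y * Complex.I * Φ (y * Complex.I)) atTop (𝓝 1)) :
    IsTightMeasureSet (Set.range μ) := by
  have hcont : Continuous fun u : ℂ => ENNReal.ofReal (2 * (1 - u).re) :=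
    ENNReal.continuous_ofReal.comp (by fun_prop)
  have hzero := (hcont.tendsto 1).comp hΦ
  simp only [sub_self, Complex.zero_re, mul_zero, ENNReal.ofReal_zero] at hzero
  refine isTightMeasureSet_range_of_tendsto_limsup_measure_norm_gt
    (tendsto_of_tendsto_of_tendsto_of_le_of_le' tendsto_const_nhds
      hzero (.of_forall fun _ => zero_le) ?_)
  filter_upwards [eventually_gt_atTop 1] with y hy
  have hlim := (hcont.tendsto _).comp
    ((h (y * Complex.I) (by simpa using hy)).const_mul (y * Complex.I))
  exact (limsup_le_limsup (.of_forall fun n => measure_norm_gt_le (μ n)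
    (zero_lt_one.trans hy))).trans_eq hlim.limsup_eq

/-- `Φ` is the Cauchy transform of a probability measure. Values are compared on `{Im z > 1}`
only, where Cauchy transforms are contractions; this determines the measure. -/
def IsCauchyTransform (Φ : ℂ → ℂ) : Prop :=
  ∃ ρ : ProbabilityMeasure ℝ, ∀ z : ℂ, 1 < z.im → cauchyTransform ρ z = Φ z

lemma isCauchyTransform_cauchyTransform (μ : Measure ℝ) [hμ : IsProbabilityMeasure μ] :
    IsCauchyTransform (cauchyTransform μ) :=
  ⟨⟨μ, hμ⟩, fun _ _ => rfl⟩

lemma IsCauchyTransform.congr {Φ Ψ : ℂ → ℂ} (hΦ : IsCauchyTransform Φ)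
    (h : ∀ z : ℂ, 1 < z.im → Φ z = Ψ z) : IsCauchyTransform Ψ :=
  hΦ.imp fun _ hρ z hz => (hρ z hz).trans (h z hz)

/-- The normalization of the limit prevents mass from escaping to infinity. -/
lemma IsCauchyTransform.of_tendsto {Φ : ℕ → ℂ → ℂ} {Ψ : ℂ → ℂ}
    (hΦ : ∀ n, IsCauchyTransform (Φ n))
    (h : ∀ z : ℂ, 1 < z.im → Tendsto (fun n => Φ n z) atTop (𝓝 (Ψ z)))
    (hΨ : Tendsto (fun y : ℝ => y * Complex.I * Ψ (y * Complex.I)) atTop (𝓝 1)) :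
    IsCauchyTransform Ψ := by
  choose P hP using hΦ
  have hlim (z : ℂ) (hz : 1 < z.im) :
      Tendsto (fun n => cauchyTransform (P n) z) atTop (𝓝 (Ψ z)) := by
    simpa only [hP _ z hz] using h z hz
  have hcompact : IsCompact (closure (Set.range P)) := by
    refine isCompact_closure_of_isTightMeasureSet ?_
    simpa only [Set.exists_range_iff, exists_prop, Set.range, Set.mem_ofPred_eq,
      exists_exists_eq_and] using isTightMeasureSet_range_of_tendsto_cauchyTransform hlim hΨ
  obtain ⟨ρ, -, hρ : Tendsto P (hyperfilter ℕ) (𝓝 ρ)⟩ :=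
    hcompact.ultrafilter_le_nhds ((hyperfilter ℕ).map P)
      (.trans (by simp) (monotone_principal subset_closure))
  rw [ProbabilityMeasure.tendsto_iff_forall_integral_rclike_tendsto ℂ] at hρ
  refine ⟨ρ, fun z hz => ?_⟩
  have hz0 : 0 < z.im := zero_lt_one.trans hz
  exact tendsto_nhds_unique (hρ (.ofNormedAddCommGroup _ (continuous_inv_sub_ofReal hz0) z.im⁻¹
    (norm_inv_sub_ofReal_le hz0))) ((hlim z hz).mono_left Nat.hyperfilter_le_atTop)

lemma IsCauchyTransform.sum {κ : Type*} {t : Finset κ} {w : κ → ℝ} (hw : ∀ k ∈ t, 0 ≤ w k)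
    (hw1 : ∑ k ∈ t, w k = 1) {Φ : κ → ℂ → ℂ} (hΦ : ∀ k, IsCauchyTransform (Φ k)) :
    IsCauchyTransform fun z => ∑ k ∈ t, w k * Φ k z := by
  choose ρ hρ using hΦ
  have hprob : IsProbabilityMeasure (∑ k ∈ t, ENNReal.ofReal (w k) • (ρ k : Measure ℝ)) :=
    ⟨by simp [Measure.finsetSum_apply, ← ENNReal.ofReal_sum_of_nonneg hw, hw1]⟩
  refine ⟨⟨_, hprob⟩, fun z hz => ?_⟩
  have hint (k : κ) : Integrable (fun x : ℝ => (z - x)⁻¹)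
      (ENNReal.ofReal (w k) • (ρ k : Measure ℝ)) :=
    (integrable_inv_sub_ofReal _ (zero_lt_one.trans hz)).smul_measure ENNReal.ofReal_ne_top
  rw [cauchyTransform, ProbabilityMeasure.coe_mk, integral_finsetSum_measure fun k _ => hint k]
  refine Finset.sum_congr rfl fun k hk => ?_
  rw [integral_smul_measure, ENNReal.toReal_ofReal (hw k hk), Complex.real_smul, ← hρ k z hz,
    cauchyTransform]

/-- Vector states of resolvents of Hermitian operators are Cauchy transforms: the measure is the
spectral measure of `T` at `e`. -/
lemma isCauchyTransform_inner {E : Type*} [NormedAddCommGroup E] [InnerProductSpace ℂ E]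
    [FiniteDimensional ℂ E] {T : E →ₗ[ℂ] E} (hT : T.IsSymmetric) {e : E} (he : ‖e‖ = 1)
    {v : ℂ → E} (hv : ∀ z : ℂ, 1 < z.im → z • v z - T (v z) = e) :
    IsCauchyTransform fun z => inner ℂ e (v z) := by
  set b := hT.eigenvectorBasis rfl
  set d := hT.eigenvalues rfl
  refine (IsCauchyTransform.sum (t := Finset.univ) (w := fun k => ‖inner ℂ (b k) e‖ ^ 2)
    (fun k _ => sq_nonneg _) (by rw [b.sum_sq_norm_inner_right, he, one_pow])
    fun k => isCauchyTransform_cauchyTransform (.dirac (d k))).congr fun z hz => ?_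
  rw [← b.sum_inner_mul_inner]
  refine Finset.sum_congr rfl fun k _ => ?_
  have hcoord : inner ℂ (b k) e = (z - d k) * inner ℂ (b k) (v z) := by
    have hTv : inner ℂ (b k) (T (v z)) = d k * inner ℂ (b k) (v z) := by
      rw [← hT, hT.apply_eigenvectorBasis rfl k, inner_smul_left]
      simp [d, b]
    rw [← hv z hz, inner_sub_right, inner_smul_right, hTv, sub_mul]
  have hne := sub_ofReal_ne_zero (zero_lt_one.trans hz) (d k)
  rw [cauchyTransform, integral_dirac, Complex.ofReal_pow, ← Complex.conj_mul',
    inner_conj_symm, hcoord]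
  field_simp

lemma im_sum_sq_div_sub_nonpos {ι : Type*} [Fintype ι] (b x : ι → ℝ) {z : ℂ} (hz : 0 < z.im) :
    (∑ i, (b i : ℂ) ^ 2 / (z - x i)).im ≤ 0 := by
  rw [Complex.im_sum]
  refine Finset.sum_nonpos fun i _ => ?_
  rw [div_eq_mul_inv, ← Complex.ofReal_pow, Complex.im_ofReal_mul, Complex.inv_im]
  refine mul_nonpos_of_nonneg_of_nonpos (sq_nonneg _)
    (div_nonpos_of_nonpos_of_nonneg ?_ (Complex.normSq_nonneg _))
  simpa using hz.le

/-- The Hermitian arrowhead matrix `[[a, b], [bᵀ, diag x]]`. Its resolvent at the first basis vector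
is, by the Schur complement formula, the reciprocal of `z - a - ∑ bᵢ² / (z - xᵢ)`. -/
noncomputable def arrowhead {ι : Type*} [DecidableEq ι] (a : ℝ) (b x : ι → ℝ) :
    Matrix (Unit ⊕ ι) (Unit ⊕ ι) ℂ :=
  .fromBlocks (.diagonal fun _ => a) (.replicateRow Unit fun i => b i)
    (.replicateCol Unit fun i => b i) (.diagonal fun i => x i)

lemma isHermitian_arrowhead {ι : Type*} [DecidableEq ι] (a : ℝ) (b x : ι → ℝ) :
    (arrowhead a b x).IsHermitian := by
  refine .fromBlocks (Matrix.isHermitian_diagonal_of_self_adjoint _ ?_) ?_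
    (Matrix.isHermitian_diagonal_of_self_adjoint _ ?_) <;> ext <;> simp

lemma isCauchyTransform_inv_sub_sub_sum {ι : Type*} [Fintype ι] (a : ℝ) (b x : ι → ℝ) :
    IsCauchyTransform fun z => (z - a - ∑ i, (b i : ℂ) ^ 2 / (z - x i))⁻¹ := by
  classical
  let s (z : ℂ) : ℂ := (z - a - ∑ i, (b i : ℂ) ^ 2 / (z - x i))⁻¹
  let v (z : ℂ) : EuclideanSpace ℂ (Unit ⊕ ι) :=
    .toLp 2 (Sum.elim (fun _ => s z) fun i => b i * s z / (z - x i))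
  let e : EuclideanSpace ℂ (Unit ⊕ ι) := .single (.inl ()) 1
  suffices hv : ∀ z : ℂ, 1 < z.im → z • v z - Matrix.toEuclideanLin (arrowhead a b x) (v z) = e from
    (isCauchyTransform_inner (Matrix.isSymmetric_toEuclideanLin_iff.2 (isHermitian_arrowhead a b x))
      (by simp [e]) hv).congr fun z _ => by simp [e, v, s, EuclideanSpace.inner_single_left]
  intro z hz
  have hz0 : 0 < z.im := zero_lt_one.trans hz
  have hs : (z - a - ∑ i, (b i : ℂ) ^ 2 / (z - x i)) * s z = 1 := by
    refine mul_inv_cancel₀ fun h => ?_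
    have him := im_sum_sq_div_sub_nonpos b x hz0
    have := congrArg Complex.im h
    simp only [Complex.sub_im, Complex.ofReal_im, Complex.zero_im] at this
    linarith
  ext (_ | i)
  · have hsum : ∑ i, b i * (b i * s z / (z - x i)) = (∑ i, (b i : ℂ) ^ 2 / (z - x i)) * s z := by
      rw [Finset.sum_mul]
      exact Finset.sum_congr rfl fun i _ => by ring
    simp [arrowhead, v, e, Matrix.fromBlocks_mulVec, Matrix.mulVec, dotProduct, hsum]
    linear_combination hs
  · have := sub_ofReal_ne_zero hz0 (x i)
    simp [arrowhead, v, e, Matrix.fromBlocks_mulVec, Matrix.mulVec, dotProduct,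
      Matrix.diagonal_apply]
    field_simp
    ring

lemma cauchyTransform_map_simpleFunc (μ : Measure ℝ) [IsFiniteMeasure μ] (s : SimpleFunc ℝ ℝ)
    (z : ℂ) :
    cauchyTransform (μ.map s) z = ∑ b ∈ s.range, μ.real (s ⁻¹' {b}) * (z - b)⁻¹ := by
  have hfibers (x : ℝ) : (z - s x)⁻¹ =
      ∑ b ∈ s.range, (s ⁻¹' {b}).indicator (fun _ => (z - b)⁻¹) x := by
    rw [Finset.sum_eq_single_of_mem (s x) (s.mem_range_self x)
      fun b _ hb => Set.indicator_of_notMem (fun h => hb h.symm) _, Set.indicator_of_mem (by rfl)]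
  rw [cauchyTransform, integral_map s.measurable.aemeasurable
    (by fun_prop : Measurable fun x : ℝ => (z - x)⁻¹).aestronglyMeasurable,
    integral_congr_ae (.of_forall hfibers), integral_finsetSum _ fun b _ =>
    (integrable_const _).indicator (s.measurableSet_fiber b)]
  simp only [integral_indicator_const _ (s.measurableSet_fiber _), Complex.real_smul]

lemma sum_measureReal_preimage_simpleFunc (μ : Measure ℝ) [IsProbabilityMeasure μ]
    (s : SimpleFunc ℝ ℝ) : ∑ b ∈ s.range, μ.real (s ⁻¹' {b}) = 1 := by
  rw [sum_measureReal_preimage_singleton _ fun b _ => s.measurableSet_fiber b,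
    SimpleFunc.coe_range, Set.preimage_range, probReal_univ]

/-- The `n`-th simple function in a sequence approximating the identity of `ℝ` pointwise, used to
discretize measures. -/
noncomputable def approxId (n : ℕ) : SimpleFunc ℝ ℝ :=
  (stronglyMeasurable_id (α := ℝ)).approx n

lemma tendsto_cauchyTransform_map_approxId (μ : Measure ℝ) [IsFiniteMeasure μ] {z : ℂ}
    (hz : 0 < z.im) : Tendsto (fun n => cauchyTransform (μ.map (approxId n)) z) atTop
      (𝓝 (cauchyTransform μ z)) := by
  have hcont := continuous_inv_sub_ofReal hz
  simp only [cauchyTransform,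
    integral_map (approxId _).measurable.aemeasurable hcont.aestronglyMeasurable]
  exact tendsto_integral_of_dominated_convergence (fun _ => z.im⁻¹)
    (fun n => (hcont.measurable.comp (approxId n).measurable).aestronglyMeasurable)
    (integrable_const _) (fun n => .of_forall fun x => norm_inv_sub_ofReal_le hz _)
    (.of_forall fun x => (hcont.tendsto x).comp (stronglyMeasurable_id.tendsto_approx x))

section Composition

variable (μ ν : Measure ℝ) [IsProbabilityMeasure μ] [IsProbabilityMeasure ν]

lemma tendsto_mul_I_mul_cauchyTransform_sub_cauchyTransform :
    Tendsto (fun y : ℝ => y * Complex.I *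
      cauchyTransform ν (y * Complex.I - cauchyTransform μ (y * Complex.I))) atTop (𝓝 1) := by
  refine tendsto_mul_I_mul_cauchyTransform_sub ν ?_
  filter_upwards [eventually_ge_atTop 1] with y hy
  have hy0 : 0 < (y * Complex.I).im := by simpa using zero_lt_one.trans_le hy
  exact ⟨(norm_cauchyTransform_le μ hy0).trans (inv_le_one_of_one_le₀ (by simpa using hy)),
    im_cauchyTransform_nonpos μ hy0⟩

lemma isCauchyTransform_inv_sub_sub_cauchyTransform (a : ℝ) :
    IsCauchyTransform fun z => (z - a - cauchyTransform μ z)⁻¹ := by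
  have hdiscrete (n : ℕ) :
      IsCauchyTransform fun z => (z - a - cauchyTransform (μ.map (approxId n)) z)⁻¹ := by
    refine (isCauchyTransform_inv_sub_sub_sum a
      (fun b : (approxId n).range => √(μ.real (approxId n ⁻¹' {b.1}))) (·.1)).congr fun z _ => ?_
    rw [cauchyTransform_map_simpleFunc, ← Finset.sum_coe_sort (approxId n).range]
    simp only [← Complex.ofReal_pow, Real.sq_sqrt measureReal_nonneg, div_eq_mul_inv]
  refine .of_tendsto hdiscrete (fun z hz => ?_) ?_
  · have hz0 : 0 < z.im := zero_lt_one.trans hz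
    refine (tendsto_const_nhds.sub (tendsto_cauchyTransform_map_approxId μ hz0)).inv₀ ?_
    rw [sub_right_comm]
    exact sub_ofReal_ne_zero (hz0.trans_le (im_le_im_sub_cauchyTransform μ hz0)) a
  · simpa [cauchyTransform, sub_right_comm] using
      tendsto_mul_I_mul_cauchyTransform_sub_cauchyTransform μ (.dirac a)

theorem isCauchyTransform_cauchyTransform_sub_cauchyTransform :
    IsCauchyTransform fun z => cauchyTransform ν (z - cauchyTransform μ z) := by
  have hdiscrete (n : ℕ) : IsCauchyTransform fun z =>
      cauchyTransform (ν.map (approxId n)) (z - cauchyTransform μ z) := by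
    simp only [cauchyTransform_map_simpleFunc, sub_right_comm _ (cauchyTransform μ _)]
    exact .sum (fun b _ => measureReal_nonneg) (sum_measureReal_preimage_simpleFunc ν _)
      fun b => isCauchyTransform_inv_sub_sub_cauchyTransform μ b
  refine .of_tendsto hdiscrete (fun z hz => tendsto_cauchyTransform_map_approxId ν ?_)
    (tendsto_mul_I_mul_cauchyTransform_sub_cauchyTransform μ ν)
  have hz0 : 0 < z.im := zero_lt_one.trans hz
  exact hz0.trans_le (im_le_im_sub_cauchyTransform μ hz0)

end Composition

/-! ### The Pastur equation -/

/-- Pastur's equation `G_ρ(z) = G_ν(z - G_ρ(z))` for the free convolution `ρ` of `ν` with the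
semicircle law. It is imposed on `{Im z > 1}`, where it determines `ρ`. -/
def IsPasturSolution (ν ρ : Measure ℝ) : Prop :=
  ∀ z : ℂ, 1 < z.im → cauchyTransform ρ z = cauchyTransform ν (z - cauchyTransform ρ z)

lemma exists_tendsto_iterate_cauchyTransform_sub (ν : Measure ℝ) [IsProbabilityMeasure ν] {z u₀ : ℂ}
    (hz : 1 < z.im) (hu₀ : u₀.im ≤ 0) :
    ∃ u : ℂ, u.im ≤ 0 ∧ u = cauchyTransform ν (z - u) ∧
      Tendsto (fun n => (fun u => cauchyTransform ν (z - u))^[n] u₀) atTop (𝓝 u) := by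
  have him {u : ℂ} (hu : u.im ≤ 0) : z.im ≤ (z - u).im := by simpa using hu
  have hz0 : 0 < z.im := zero_lt_one.trans hz
  have hmaps : Set.MapsTo (fun u => cauchyTransform ν (z - u)) {u | u.im ≤ 0} {u | u.im ≤ 0} :=
    fun u hu => im_cauchyTransform_nonpos ν (hz0.trans_le (him hu))
  have hcontr : ContractingWith ⟨z.im⁻¹, by positivity⟩ (hmaps.restrict _ _ _) := by
    refine ⟨inv_lt_one_of_one_lt₀ hz, .of_dist_le_mul fun ⟨u, hu⟩ ⟨v, hv⟩ => ?_⟩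
    have hu' := hz0.trans_le (him hu)
    have hv' := hz0.trans_le (him hv)
    simp only [Set.MapsTo.restrict, Subtype.map, Subtype.dist_eq, dist_eq_norm]
    calc ‖cauchyTransform ν (z - u) - cauchyTransform ν (z - v)‖
        ≤ ‖(z - u) - (z - v)‖ * ((z - u).im⁻¹ * (z - v).im⁻¹) :=
          norm_cauchyTransform_sub_cauchyTransform_le ν hu' hv'
      _ ≤ ‖u - v‖ * (z.im⁻¹ * 1) := by
          rw [sub_sub_sub_cancel_left, norm_sub_rev]
          gcongr
          · exact him hu
          · exact inv_le_one_of_one_le₀ (hz.le.trans (him hv))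
      _ = z.im⁻¹ * ‖u - v‖ := by ring
  obtain ⟨u, hu, hfix, hlim, -⟩ := hcontr.exists_fixedPoint'
    (isClosed_le Complex.continuous_im continuous_const).isComplete hmaps hu₀ (edist_ne_top _ _)
  exact ⟨u, hu, hfix.symm, hlim⟩

theorem exists_isPasturSolution (ν : Measure ℝ) [IsProbabilityMeasure ν] :
    ∃ ρ : Measure ℝ, IsProbabilityMeasure ρ ∧ IsPasturSolution ν ρ := by
  choose! Φ him hfix hlim using fun (z : ℂ) (hz : 1 < z.im) =>
    exists_tendsto_iterate_cauchyTransform_sub ν hz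
      (im_cauchyTransform_nonpos ν (zero_lt_one.trans hz))
  have hiterate (n : ℕ) : IsCauchyTransform fun z =>
      (fun u => cauchyTransform ν (z - u))^[n] (cauchyTransform ν z) := by
    induction n with
    | zero => exact isCauchyTransform_cauchyTransform ν
    | succ n ih =>
      obtain ⟨ρ, hρ⟩ := ih
      refine (isCauchyTransform_cauchyTransform_sub_cauchyTransform ρ ν).congr fun z hz => ?_
      rw [Function.iterate_succ_apply', hρ z hz]
  obtain ⟨ρ, hρ⟩ : IsCauchyTransform Φ := by
    refine .of_tendsto hiterate hlim ((tendsto_mul_I_mul_cauchyTransform_sub ν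
      (u := fun y => Φ (y * Complex.I)) ?_).congr' ?_)
    · filter_upwards [eventually_gt_atTop 1] with y hy
      have hz : 1 < (y * Complex.I).im := by simpa using hy
      have hle : 1 ≤ (y * Complex.I - Φ (y * Complex.I)).im := by
        rw [Complex.sub_im]
        linarith [him _ hz]
      refine ⟨?_, him _ hz⟩
      rw [hfix _ hz]
      exact (norm_cauchyTransform_le ν (zero_lt_one.trans_le hle)).trans
        (inv_le_one_of_one_le₀ hle)
    · filter_upwards [eventually_gt_atTop 1] with y hy
      rw [← hfix _ (by simpa using hy)]
  exact ⟨ρ, inferInstance, fun z hz => by rw [hρ z hz, ← hfix z hz]⟩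

lemma eventually_one_lt_im {z₀ : ℂ} (hz₀ : 1 < z₀.im) : ∀ᶠ z : ℂ in 𝓝[≠] z₀, 1 < z.im :=
  eventually_nhdsWithin_of_eventually_nhds
    (Complex.continuous_im.continuousAt.eventually (eventually_gt_nhds hz₀))

theorem IsPasturSolution.eq_of_frequently {ν ρ ρ' : Measure ℝ} [IsProbabilityMeasure ν]
    [IsProbabilityMeasure ρ] [IsProbabilityMeasure ρ'] (h : IsPasturSolution ν ρ) {z₀ : ℂ}
    (hz₀ : 1 < z₀.im)
    (h' : ∃ᶠ z in 𝓝[≠] z₀, cauchyTransform ρ' z = cauchyTransform ν (z - cauchyTransform ρ' z)) :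
    ρ' = ρ := by
  refine ext_of_frequently_cauchyTransform_eq (zero_lt_one.trans hz₀) ?_
  refine (h'.and_eventually (eventually_one_lt_im hz₀)).mono fun z ⟨hz', hz⟩ => ?_
  have hz0 : 0 < z.im := zero_lt_one.trans hz
  exact eq_of_eq_cauchyTransform_sub ν hz' (h z hz)
    (hz.trans_le (im_le_im_sub_cauchyTransform ρ' hz0))
    (hz.trans_le (im_le_im_sub_cauchyTransform ρ hz0))

lemma cauchyTransform_map_neg (μ : Measure ℝ) (z : ℂ) :
    cauchyTransform (μ.map fun x => -x) z =
      -starRingEnd ℂ (cauchyTransform μ (-starRingEnd ℂ z)) := by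
  rw [cauchyTransform, integral_map (by fun_prop)
    (by fun_prop : Measurable fun x : ℝ => (z - x)⁻¹).aestronglyMeasurable, cauchyTransform,
    ← integral_conj, ← integral_neg]
  refine integral_congr_ae (.of_forall fun x => ?_)
  simp only [map_inv₀, map_sub, map_neg, Complex.conj_conj, Complex.conj_ofReal,
    Complex.ofReal_neg, ← inv_neg]
  ring

theorem IsPasturSolution.isSymmetric {ν ρ : Measure ℝ} [IsProbabilityMeasure ν]
    [IsProbabilityMeasure ρ] (h : IsPasturSolution ν ρ) (hν : IsSymmetric ν) : IsSymmetric ρ := by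
  have : IsProbabilityMeasure (ρ.map fun x => -x) := Measure.isProbabilityMeasure_map (by fun_prop)
  have hodd (w : ℂ) : cauchyTransform ν w = -starRingEnd ℂ (cauchyTransform ν (-starRingEnd ℂ w)) :=
    by simpa only [show ν.map (fun x => -x) = ν from hν] using cauchyTransform_map_neg ν w
  have hz₀ : 1 < (2 * Complex.I).im := by simp
  refine h.eq_of_frequently hz₀ (Filter.Eventually.frequently ?_)
  filter_upwards [eventually_one_lt_im hz₀] with z hz
  rw [cauchyTransform_map_neg, hodd]
  conv_lhs => rw [h _ (by simpa using hz)]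
  simp [sub_eq_add_neg, add_comm]

/-! ### The semicircle law -/

lemma integral_semicircle {E : Type*} [NormedAddCommGroup E] [NormedSpace ℝ E] {f : ℝ → E}
    (hf : Continuous f) : ∫ x, f x ∂semicircle =
      ∫ θ in 0..Real.pi, (2 / Real.pi * Real.sin θ ^ 2) • f (2 * Real.cos θ) := by
  let g (x : ℝ) : E := (√(4 - x ^ 2) / (2 * Real.pi)) • f x
  have hdensity : ∫ x, f x ∂semicircle = ∫ x in (-2 : ℝ)..2, g x := by
    rw [semicircle, integral_withDensity_eq_integral_toReal_smul (by fun_prop)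
      (.of_forall fun _ => ENNReal.ofReal_lt_top), intervalIntegral.integral_of_le (by norm_num),
      ← integral_Icc_eq_integral_Ioc]
    exact integral_congr_ae (.of_forall fun x => by
      simp only [g, ENNReal.toReal_ofReal (by positivity : 0 ≤ √(4 - x ^ 2) / (2 * Real.pi))])
  have hsubst := intervalIntegral.integral_deriv_smul_comp (a := 0) (b := Real.pi)
    (f := fun θ => 2 * Real.cos θ) (f' := fun θ => 2 * -Real.sin θ) (g := g)
    (fun θ _ => (Real.hasDerivAt_cos θ).const_mul 2) (by fun_prop) (by fun_prop)
  simp only [Real.cos_zero, mul_one, Real.cos_pi, mul_neg] at hsubst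
  rw [hdensity, intervalIntegral.integral_symm, ← hsubst, ← intervalIntegral.integral_neg]
  refine intervalIntegral.integral_congr fun θ hθ => ?_
  have hsin : 0 ≤ Real.sin θ := by
    rw [Set.uIcc_of_le Real.pi_pos.le] at hθ
    exact Real.sin_nonneg_of_mem_Icc hθ
  have hsqrt : √(4 - (2 * Real.cos θ) ^ 2) = 2 * Real.sin θ := by
    rw [show 4 - (2 * Real.cos θ) ^ 2 = (2 * Real.sin θ) ^ 2 by
      linear_combination -4 * Real.sin_sq_add_cos_sq θ, Real.sqrt_sq (by positivity)]
  simp only [Function.comp_apply, g, hsqrt, smul_smul, neg_mul]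
  rw [neg_smul, neg_neg]
  congr 1
  field_simp

lemma sin_sq_div_eq_div_add_div {r : ℂ} {θ : ℝ} (h₁ : 1 - r * circleMap 0 1 θ ≠ 0)
    (h₂ : 1 - r * (circleMap 0 1 θ)⁻¹ ≠ 0) :
    (Real.sin θ : ℂ) ^ 2 / (1 - 2 * r * Real.cos θ + r ^ 2) =
      ((1 - circleMap 0 1 θ ^ 2) / (1 - r * circleMap 0 1 θ) +
        (1 - (circleMap 0 1 θ)⁻¹ ^ 2) / (1 - r * (circleMap 0 1 θ)⁻¹)) / 4 := by
  have he := circleMap_ne_center (c := 0) (θ := θ) one_ne_zero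
  have hcos : (Real.cos θ : ℂ) = (circleMap 0 1 θ + (circleMap 0 1 θ)⁻¹) / 2 := by
    rw [Complex.ofReal_cos, Complex.cos, circleMap_zero, Complex.ofReal_one, one_mul,
      ← Complex.exp_neg, neg_mul]
  have hsin : (Real.sin θ : ℂ) ^ 2 = 1 - (Real.cos θ : ℂ) ^ 2 := by
    exact_mod_cast Real.sin_sq θ
  have hden : 1 - 2 * r * Real.cos θ + r ^ 2 =
      (1 - r * circleMap 0 1 θ) * (1 - r * (circleMap 0 1 θ)⁻¹) := by
    rw [hcos]
    field_simp
    ring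
  rw [hden, hsin, hcos, div_add_div _ _ h₁ h₂, div_div, div_eq_div_iff
    (mul_ne_zero h₁ h₂) (mul_ne_zero (mul_ne_zero h₁ h₂) (by norm_num))]
  field_simp
  ring

/-- On the unit circle `w = e^{iθ}`, writing `h(w) = (1 - w²) / (1 - r w)`, the integrand is
`(h(w) + h(w⁻¹)) / 4`, so the integral is a quarter of the integral of the holomorphic function `h`
over the whole circle. -/
lemma integral_sin_sq_div {r : ℂ} (hr : ‖r‖ < 1) :
    ∫ θ in 0..Real.pi, (Real.sin θ : ℂ) ^ 2 / (1 - 2 * r * Real.cos θ + r ^ 2) =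
      (Real.pi : ℂ) / 2 := by
  let h (w : ℂ) : ℂ := (1 - w ^ 2) / (1 - r * w)
  have hne {w : ℂ} (hw : ‖w‖ ≤ 1) : 1 - r * w ≠ 0 := fun h0 => by
    have : ‖r * w‖ < 1 := by
      rw [norm_mul]
      exact mul_lt_one_of_nonneg_of_lt_one_left (norm_nonneg _) hr hw
    rw [← sub_eq_zero.1 h0, norm_one] at this
    exact lt_irrefl _ this
  have hmean : Real.circleAverage h 0 1 = 1 := by
    rw [DiffContOnCl.circleAverage]
    · simp [h]
    · refine DifferentiableOn.diffContOnCl fun w hw => ?_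
      rw [abs_one, closure_ball _ one_ne_zero, mem_closedBall_zero_iff] at hw
      exact DifferentiableAt.differentiableWithinAt
        (by fun_prop (disch := exact hne hw))
  have hcont : Continuous fun θ => h (circleMap 0 1 θ) :=
    .div (by fun_prop) (by fun_prop) fun θ => hne (by simp)
  have hrefl (θ : ℝ) : circleMap 0 1 (2 * Real.pi - θ) = (circleMap 0 1 θ)⁻¹ := by
    rw [(periodic_circleMap 0 1).sub_eq', circleMap_zero_inv, inv_one]
  have hfold (θ : ℝ) : (Real.sin θ : ℂ) ^ 2 / (1 - 2 * r * Real.cos θ + r ^ 2) =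
      (h (circleMap 0 1 θ) + h (circleMap 0 1 (2 * Real.pi - θ))) / 4 := by
    simp only [h, hrefl]
    exact sin_sq_div_eq_div_add_div (hne (by simp)) (hne (by simp))
  have hint (a b : ℝ) : IntervalIntegrable (fun θ => h (circleMap 0 1 θ)) volume a b :=
    hcont.intervalIntegrable a b
  have hint' : IntervalIntegrable (fun θ => h (circleMap 0 1 (2 * Real.pi - θ))) volume 0 Real.pi :=
    (hcont.comp (continuous_sub_left _)).intervalIntegrable _ _
  simp only [hfold]
  rw [intervalIntegral.integral_div, intervalIntegral.integral_add (hint _ _) hint',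
    intervalIntegral.integral_comp_sub_left (fun θ => h (circleMap 0 1 θ)), sub_zero,
    show 2 * Real.pi - Real.pi = Real.pi by ring,
    intervalIntegral.integral_add_adjacent_intervals (hint _ _) (hint _ _)]
  rw [Real.circleAverage_def, inv_smul_eq_iff₀ Real.two_pi_pos.ne', Complex.real_smul] at hmean
  rw [hmean]
  push_cast
  ring

lemma im_pos_iff_im_add_inv_pos {ζ : ℂ} (h : 1 < ‖ζ‖) : 0 < ζ.im ↔ 0 < (ζ + ζ⁻¹).im := by
  have him : (ζ + ζ⁻¹).im = ζ.im * (1 - (‖ζ‖ ^ 2)⁻¹) := by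
    rw [Complex.add_im, Complex.inv_im, Complex.normSq_eq_norm_sq]
    ring
  rw [him, mul_pos_iff_of_pos_right (sub_pos.2 (inv_lt_one_of_one_lt₀ (one_lt_pow₀ h two_ne_zero)))]

theorem cauchyTransform_semicircle {ζ : ℂ} (hζ : 1 < ‖ζ‖) (him : 0 < ζ.im) :
    cauchyTransform semicircle (ζ + ζ⁻¹) = ζ⁻¹ := by
  have hz : 0 < (ζ + ζ⁻¹).im := (im_pos_iff_im_add_inv_pos hζ).1 him
  have hζ0 : ζ ≠ 0 := norm_pos_iff.1 (zero_lt_one.trans hζ)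
  have hr : ‖ζ⁻¹‖ < 1 := by
    rw [norm_inv]
    exact inv_lt_one_of_one_lt₀ hζ
  have hpi : (Real.pi : ℂ) ≠ 0 := by exact_mod_cast Real.pi_ne_zero
  have hintegrand (θ : ℝ) : (2 / Real.pi * Real.sin θ ^ 2) •
      (ζ + ζ⁻¹ - (2 * Real.cos θ : ℝ))⁻¹ = 2 * ζ⁻¹ / Real.pi *
        ((Real.sin θ : ℂ) ^ 2 / (1 - 2 * ζ⁻¹ * Real.cos θ + ζ⁻¹ ^ 2)) := by
    have hden : 1 - 2 * ζ⁻¹ * Real.cos θ + ζ⁻¹ ^ 2 =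
        ζ⁻¹ * (ζ + ζ⁻¹ - (2 * Real.cos θ : ℝ)) := by
      push_cast
      field_simp
      ring
    have hne := sub_ofReal_ne_zero hz (2 * Real.cos θ)
    rw [hden, Complex.real_smul]
    push_cast at hne ⊢
    field_simp
  rw [cauchyTransform, integral_semicircle (continuous_inv_sub_ofReal hz)]
  simp only [hintegrand]
  rw [intervalIntegral.integral_const_mul, integral_sin_sq_div hr]
  field_simp

lemma exists_one_lt_norm_eq_add_inv {w : ℂ} (hw : 0 < w.im) : ∃ ζ : ℂ, 1 < ‖ζ‖ ∧ w = ζ + ζ⁻¹ := by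
  obtain ⟨ζ, hζ⟩ := IsAlgClosed.exists_root (Polynomial.C 1 * .X ^ 2 + .C (-w) * .X + .C 1) (by
    rw [Polynomial.degree_quadratic one_ne_zero]
    decide)
  replace hζ : ζ ^ 2 + -w * ζ + 1 = 0 := by simpa using hζ
  have hζ0 : ζ ≠ 0 := by
    rintro rfl
    simp at hζ
  have hw' : w = ζ + ζ⁻¹ := by
    field_simp
    linear_combination -hζ
  rcases lt_trichotomy ‖ζ‖ 1 with hlt | heq | hgt
  · refine ⟨ζ⁻¹, ?_, by rw [inv_inv, add_comm, hw']⟩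
    rw [norm_inv]
    exact (one_lt_inv₀ (norm_pos_iff.2 hζ0)).2 hlt
  · rw [hw', Complex.add_im, Complex.inv_im, Complex.normSq_eq_norm_sq, heq] at hw
    simp at hw
  · exact ⟨ζ, hgt, hw'⟩

theorem eq_add_inv_of_cauchyTransform_semicircle {w z : ℂ} (hw : 0 < w.im)
    (h : cauchyTransform semicircle w = z⁻¹) : w = z + z⁻¹ := by
  obtain ⟨ζ, hζ, rfl⟩ := exists_one_lt_norm_eq_add_inv hw
  rw [cauchyTransform_semicircle hζ ((im_pos_iff_im_add_inv_pos hζ).2 hw)] at h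
  rw [inv_injective h]

/-! ### Voiculescu transforms -/

section SelfEnergy

variable (μ : Measure ℝ) [IsProbabilityMeasure μ]

/-- The self-energy `Σ_μ(w) = w - F_μ(w)`. The right inverse of `F_μ` maps `z` to the fixed point of
`w ↦ z + Σ_μ(w)`. -/
noncomputable def selfEnergy (μ : Measure ℝ) (w : ℂ) : ℂ :=
  w - reciprocalCauchyTransform μ w

lemma cauchyTransform_ne_zero {w : ℂ} (hw : 0 < w.im) : cauchyTransform μ w ≠ 0 := fun h => by
  have him (x : ℝ) : ((w - x)⁻¹).im < 0 := by
    simp only [Complex.inv_im, Complex.sub_im, Complex.ofReal_im, sub_zero]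
    exact div_neg_of_neg_of_pos (neg_lt_zero.2 hw)
      (Complex.normSq_pos.2 (sub_ofReal_ne_zero hw x))
  have hzero : ∫ x : ℝ, -((w - x)⁻¹).im ∂μ = 0 := by
    rw [integral_neg, ← im_cauchyTransform μ hw, h, Complex.zero_im, neg_zero]
  rw [integral_eq_zero_iff_of_nonneg (fun x => neg_nonneg.2 (him x).le)
    (integrable_inv_sub_ofReal μ hw).im.neg] at hzero
  obtain ⟨x, hx⟩ := hzero.exists
  exact (him x).ne (neg_eq_zero.1 hx)

lemma differentiableAt_selfEnergy {w : ℂ} (hw : 0 < w.im) :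
    DifferentiableAt ℂ (selfEnergy μ) w :=
  differentiableAt_id.sub (((differentiableOn_cauchyTransform μ).differentiableAt
    ((isOpen_lt continuous_const Complex.continuous_im).mem_nhds hw)).inv
      (cauchyTransform_ne_zero μ hw))

lemma integrable_div_cauchyTransform {w : ℂ} (hw : 0 < w.im) :
    Integrable (fun x : ℝ => (w - x)⁻¹ / cauchyTransform μ w) μ :=
  (integrable_inv_sub_ofReal μ hw).div_const _

lemma integral_div_cauchyTransform {w : ℂ} (hw : 0 < w.im) :
    ∫ x : ℝ, (w - x)⁻¹ / cauchyTransform μ w ∂μ = 1 := by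
  rw [integral_div, ← cauchyTransform, div_self (cauchyTransform_ne_zero μ hw)]

lemma integrable_norm_div_cauchyTransform_sub_one_sq {w : ℂ} (hw : 0 < w.im) :
    Integrable (fun x : ℝ => ‖(w - x)⁻¹ / cauchyTransform μ w - 1‖ ^ 2) μ := by
  have hcont : Continuous fun x : ℝ => ‖(w - x)⁻¹ / cauchyTransform μ w - 1‖ ^ 2 :=
    ((((continuous_inv_sub_ofReal hw).div_const _).sub continuous_const).norm).pow 2
  refine .of_bound hcont.aestronglyMeasurable ((w.im⁻¹ / ‖cauchyTransform μ w‖ + 1) ^ 2)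
    (.of_forall fun x => ?_)
  rw [norm_pow, norm_norm]
  gcongr
  refine (norm_sub_le _ _).trans ?_
  rw [norm_div, norm_one]
  gcongr
  exact norm_inv_sub_ofReal_le hw x

lemma integral_norm_div_cauchyTransform_sub_one_sq {w : ℂ} (hw : 0 < w.im) :
    ∫ x : ℝ, ‖(w - x)⁻¹ / cauchyTransform μ w - 1‖ ^ 2 ∂μ = -(selfEnergy μ w).im / w.im := by
  set G := cauchyTransform μ w with hG
  have hG0 : G ≠ 0 := cauchyTransform_ne_zero μ hw
  have hpointwise (x : ℝ) : ‖(w - x)⁻¹ / G - 1‖ ^ 2 =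
      -((w - x)⁻¹).im / (w.im * ‖G‖ ^ 2) - 2 * ((w - x)⁻¹ / G).re + 1 := by
    have hsq : ‖(w - x)⁻¹‖ ^ 2 = -((w - x)⁻¹).im / w.im := by
      rw [Complex.inv_im, norm_inv, inv_pow, ← Complex.normSq_eq_norm_sq, Complex.sub_im,
        Complex.ofReal_im, sub_zero]
      field_simp
    rw [← Complex.normSq_eq_norm_sq, Complex.normSq_sub, Complex.normSq_eq_norm_sq, norm_div,
      div_pow, hsq, div_div, map_one, map_one, mul_one]
    ring
  have hre : Integrable (fun x : ℝ => 2 * ((w - x)⁻¹ / G).re) μ :=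
    (integrable_div_cauchyTransform μ hw).re.const_mul 2
  have him : Integrable (fun x : ℝ => -((w - x)⁻¹).im / (w.im * ‖G‖ ^ 2)) μ :=
    (integrable_inv_sub_ofReal μ hw).im.neg.div_const _
  have hone : ∫ x : ℝ, ((w - x)⁻¹ / G).re ∂μ = 1 := by
    rw [← Complex.one_re, ← integral_div_cauchyTransform μ hw]
    exact integral_re (integrable_div_cauchyTransform μ hw)
  simp only [hpointwise]
  rw [integral_add (him.sub' hre) (integrable_const _), integral_sub him hre, integral_div,
    integral_neg, integral_const_mul, hone, ← im_cauchyTransform μ hw, ← hG, selfEnergy,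
    reciprocalCauchyTransform, ← hG, Complex.sub_im, Complex.inv_im, Complex.normSq_eq_norm_sq]
  simp only [integral_const, probReal_univ, smul_eq_mul, mul_one]
  have : ‖G‖ ≠ 0 := norm_ne_zero_iff.2 hG0
  field_simp
  ring

end SelfEnergy

section FiniteVariance

variable {μ : Measure ℝ} [IsProbabilityMeasure μ]

lemma selfEnergy_sub_integral (hμ : MemLp id 2 μ) {w : ℂ} (hw : 0 < w.im) :
    selfEnergy μ w - (μ[id] : ℝ) =
      ∫ x : ℝ, ((x - μ[id] : ℝ) : ℂ) * ((w - x)⁻¹ / cauchyTransform μ w - 1) ∂μ := by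
  set m := μ[id]
  set G := cauchyTransform μ w
  have hG0 : G ≠ 0 := cauchyTransform_ne_zero μ hw
  have hcenter : Integrable (fun x : ℝ => ((x - m : ℝ) : ℂ)) μ :=
    ((hμ.integrable one_le_two).sub (integrable_const m)).ofReal
  have hmean : ∫ x : ℝ, ((x - m : ℝ) : ℂ) ∂μ = 0 := by
    have hid : Integrable (fun x : ℝ => x) μ := hμ.integrable one_le_two
    rw [integral_complex_ofReal, integral_sub hid (integrable_const m)]
    simp [m]
  have hpointwise (x : ℝ) : ((x - m : ℝ) : ℂ) * ((w - x)⁻¹ / G - 1) =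
      (w - m) * ((w - x)⁻¹ / G) - G⁻¹ - ((x - m : ℝ) : ℂ) := by
    have := sub_ofReal_ne_zero hw x
    push_cast
    field_simp
    ring
  have hint : Integrable (fun x : ℝ => (w - m) * ((w - x)⁻¹ / G)) μ :=
    (integrable_div_cauchyTransform μ hw).const_mul _
  simp only [hpointwise]
  rw [integral_sub (hint.sub' (integrable_const _)) hcenter,
    integral_sub hint (integrable_const _), integral_const_mul, integral_div_cauchyTransform μ hw,
    hmean, selfEnergy, reciprocalCauchyTransform, integral_const, probReal_univ, one_smul]
  ring

/-- With `u(x) = (w - x)⁻¹ / G_μ(w)` and `m` the mean, `Σ_μ(w) - m = ∫ (x - m) (u - 1)` while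
`∫ |u - 1|² = - Im Σ_μ(w) / Im w`; the weighted AM-GM inequality gives
`2 |Σ_μ(w) - m| ≤ Var / Im w - Im Σ_μ(w)`. -/
theorem norm_selfEnergy_sub_integral_le (hμ : MemLp id 2 μ) {w : ℂ} (hw : 0 < w.im) :
    ‖selfEnergy μ w - (μ[id] : ℝ)‖ ≤ Var[id; μ] / w.im := by
  have hcenter : Integrable (fun x : ℝ => (x - μ[id]) ^ 2) μ :=
    (hμ.sub (memLp_const _)).integrable_sq
  have hdev := integrable_norm_div_cauchyTransform_sub_one_sq μ hw
  have hamgm (x : ℝ) : ‖((x - μ[id] : ℝ) : ℂ) * ((w - x)⁻¹ / cauchyTransform μ w - 1)‖ ≤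
      (x - μ[id]) ^ 2 * (2 * w.im)⁻¹ +
        ‖(w - x)⁻¹ / cauchyTransform μ w - 1‖ ^ 2 * (w.im / 2) := by
    rw [norm_mul, Complex.norm_real, Real.norm_eq_abs, ← sq_abs]
    generalize |x - μ[id]| = a, ‖(w - x)⁻¹ / cauchyTransform μ w - 1‖ = b
    have hsq : a ^ 2 * (2 * w.im)⁻¹ + b ^ 2 * (w.im / 2) - a * b =
        (a - b * w.im) ^ 2 / (2 * w.im) := by
      field_simp
      ring
    rw [← sub_nonneg, hsq]
    positivity
  have hle : ‖selfEnergy μ w - (μ[id] : ℝ)‖ ≤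
      Var[id; μ] * (2 * w.im)⁻¹ - (selfEnergy μ w).im / 2 := by
    calc
      _ ≤ ∫ x : ℝ, ((x - μ[id]) ^ 2 * (2 * w.im)⁻¹ +
          ‖(w - x)⁻¹ / cauchyTransform μ w - 1‖ ^ 2 * (w.im / 2)) ∂μ := by
        rw [selfEnergy_sub_integral hμ hw]
        exact norm_integral_le_of_norm_le ((hcenter.mul_const _).add (hdev.mul_const _))
          (.of_forall hamgm)
      _ = _ := by
        rw [integral_add (hcenter.mul_const _) (hdev.mul_const _), integral_mul_const,
          integral_mul_const, integral_norm_div_cauchyTransform_sub_one_sq μ hw,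
          variance_eq_integral aemeasurable_id]
        simp only [id_eq]
        field_simp
        ring
  have him : -(selfEnergy μ w).im ≤ ‖selfEnergy μ w - (μ[id] : ℝ)‖ := by
    simpa using (neg_le_abs _).trans (Complex.abs_im_le_norm (selfEnergy μ w - (μ[id] : ℝ)))
  have hhalf : Var[id; μ] * (2 * w.im)⁻¹ = Var[id; μ] / w.im / 2 := by ring
  linarith

variable {c : ℝ} (hc : 0 < c) (hvar : 8 * Var[id; μ] ≤ c ^ 2)

include hc hvar

/-- Cauchy's estimate on discs of radius `c / 2`. -/
lemma norm_deriv_selfEnergy_le (hμ : MemLp id 2 μ) {w : ℂ} (hw : c ≤ w.im) :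
    ‖deriv (selfEnergy μ) w‖ ≤ 1 / 2 := by
  have him {w' : ℂ} (hw' : w' ∈ Metric.closedBall w (c / 2)) : c / 2 ≤ w'.im := by
    rw [mem_closedBall_iff_norm'] at hw'
    have := (le_abs_self _).trans ((Complex.abs_im_le_norm (w - w')).trans hw')
    rw [Complex.sub_im] at this
    linarith
  have hderiv : deriv (fun w' => selfEnergy μ w' - (μ[id] : ℝ)) w = deriv (selfEnergy μ) w :=
    deriv_sub_const _
  rw [← hderiv]
  have hcauchy := Complex.norm_deriv_le_of_forall_mem_sphere_norm_le (half_pos hc)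
    (C := Var[id; μ] / (c / 2)) (c := w) (f := fun w' => selfEnergy μ w' - (μ[id] : ℝ))
    (DifferentiableOn.diffContOnCl fun w' hw' => ?_) fun w' hw' => ?_
  · refine hcauchy.trans ?_
    rw [div_div, div_le_iff₀ (by positivity)]
    linarith
  · rw [closure_ball _ (half_pos hc).ne'] at hw'
    exact ((differentiableAt_selfEnergy μ ((half_pos hc).trans_le (him hw'))).sub_const
      _).differentiableWithinAt
  · have hle := him (Metric.sphere_subset_closedBall hw')
    refine (norm_selfEnergy_sub_integral_le hμ ((half_pos hc).trans_le hle)).trans ?_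
    gcongr
    exact variance_nonneg _ _

lemma norm_selfEnergy_sub_selfEnergy_le (hμ : MemLp id 2 μ) {w w' : ℂ} (hw : c ≤ w.im)
    (hw' : c ≤ w'.im) : ‖selfEnergy μ w - selfEnergy μ w'‖ ≤ 1 / 2 * ‖w - w'‖ :=
  (convex_halfSpace_im_ge c).norm_image_sub_le_of_norm_deriv_le
    (fun _ hv => differentiableAt_selfEnergy μ (hc.trans_le hv))
    (fun _ hv => norm_deriv_selfEnergy_le hc hvar hμ hv) hw' hw

lemma norm_selfEnergy_le (hμ : MemLp id 2 μ) {w : ℂ} (hw : c ≤ w.im) :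
    ‖selfEnergy μ w‖ ≤ |μ[id]| + c / 8 := by
  have hle : Var[id; μ] / w.im ≤ c / 8 := by
    rw [div_le_iff₀ (hc.trans_le hw)]
    nlinarith
  rw [← Real.norm_eq_abs, ← Complex.norm_real]
  linarith [norm_le_norm_add_norm_sub' (selfEnergy μ w) (μ[id] : ℝ),
    norm_selfEnergy_sub_integral_le hμ (hc.trans_le hw)]

lemma exists_reciprocalCauchyTransform_eq (hμ : MemLp id 2 μ) {z : ℂ} (hz : 2 * c < z.im) :
    ∃ w : ℂ, c < w.im ∧ reciprocalCauchyTransform μ w = z := by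
  have him {w : ℂ} (hw : c ≤ w.im) : c < (z + selfEnergy μ w).im := by
    have hle : Var[id; μ] / w.im ≤ c / 8 := by
      rw [div_le_iff₀ (hc.trans_le hw)]
      nlinarith
    have := (neg_le_abs _).trans ((Complex.abs_im_le_norm _).trans
      (norm_selfEnergy_sub_integral_le hμ (hc.trans_le hw)))
    rw [Complex.sub_im, Complex.ofReal_im, sub_zero] at this
    rw [Complex.add_im]
    linarith
  have hmaps : Set.MapsTo (fun w => z + selfEnergy μ w) {w : ℂ | c ≤ w.im} {w | c ≤ w.im} :=
    fun w hw => (him hw).le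
  have hcontr : ContractingWith (1 / 2) (hmaps.restrict _ _ _) := by
    refine ⟨by rw [← NNReal.coe_lt_coe]; norm_num, LipschitzWith.of_dist_le_mul fun w w' => ?_⟩
    rw [Subtype.dist_eq, Subtype.dist_eq, dist_eq_norm, dist_eq_norm]
    simp only [Set.MapsTo.val_restrict_apply, add_sub_add_left_eq_sub]
    exact_mod_cast norm_selfEnergy_sub_selfEnergy_le hc hvar hμ w.2 w'.2
  obtain ⟨w, hw, hfix, -⟩ := hcontr.exists_fixedPoint'
    (isClosed_le continuous_const Complex.continuous_im).isComplete hmaps (x := z)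
    (by simp only [Set.mem_ofPred_eq]; linarith) (edist_ne_top _ _)
  replace hfix : z + selfEnergy μ w = w := hfix
  refine ⟨w, by simpa only [hfix] using him hw, ?_⟩
  rw [selfEnergy] at hfix
  linear_combination -hfix

lemma differentiableOn_of_reciprocalCauchyTransform_eq (hμ : MemLp id 2 μ) {U : Set ℂ}
    (hU : IsOpen U) {W : ℂ → ℂ} (him : ∀ z ∈ U, c ≤ (W z).im)
    (hW : ∀ z ∈ U, reciprocalCauchyTransform μ (W z) = z) : DifferentiableOn ℂ W U := by
  intro z hz
  have hlip : LipschitzOnWith 2 W U := LipschitzOnWith.of_dist_le_mul fun z hz z' hz' => by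
    rw [dist_eq_norm, dist_eq_norm, NNReal.coe_two]
    have hle := norm_selfEnergy_sub_selfEnergy_le hc hvar hμ (him z hz) (him z' hz')
    rw [selfEnergy, selfEnergy, hW z hz, hW z' hz'] at hle
    have htri := norm_le_norm_add_norm_sub' (W z - W z') (z - z')
    rw [sub_sub_sub_comm] at htri
    linarith
  have hcont : ContinuousAt W z := hlip.continuousOn.continuousAt (hU.mem_nhds hz)
  have hdiff := differentiableAt_selfEnergy μ (hc.trans_le (him z hz))
  have hderiv :
      HasDerivAt (reciprocalCauchyTransform μ) (1 - deriv (selfEnergy μ) (W z)) (W z) := by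
    simpa [selfEnergy, Pi.sub_def] using (hasDerivAt_id (W z)).sub hdiff.hasDerivAt
  have hne : 1 - deriv (selfEnergy μ) (W z) ≠ 0 := fun h0 => by
    have hle := norm_deriv_selfEnergy_le hc hvar hμ (him z hz)
    rw [← sub_eq_zero.1 h0, norm_one] at hle
    norm_num at hle
  exact (hderiv.of_local_left_inverse hcont hne
    ((hU.eventually_mem hz).mono hW)).differentiableAt.differentiableWithinAt

omit hc hvar

lemma tendsto_div_of_forall_norm_le {φ : ℂ → ℂ} {S : Set ℂ} {C : ℝ} (h : ∀ z ∈ S, ‖φ z‖ ≤ C) :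
    Tendsto (fun z => φ z / z) (cobounded ℂ ⊓ 𝓟 S) (𝓝 0) := by
  simp only [div_eq_mul_inv]
  exact isBoundedUnder_of_eventually_le (eventually_inf_principal.2 (.of_forall h))
    |>.smul_tendsto_zero (tendsto_inv₀_cobounded.mono_left inf_le_left)

include hc hvar in
theorem exists_isVoiculescuTransform (hμ : MemLp id 2 μ) (α : ℝ) :
    ∃ φ : ℂ → ℂ, IsVoiculescuTransform μ α (2 * c) φ ∧
      ∀ z ∈ cone α (2 * c), c < (z + φ z).im := by
  have hex (z : ℂ) : ∃ w : ℂ, 2 * c < z.im → c < w.im ∧ reciprocalCauchyTransform μ w = z := by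
    by_cases hz : 2 * c < z.im
    · exact (exists_reciprocalCauchyTransform_eq hc hvar hμ hz).imp fun _ hw _ => hw
    · exact ⟨0, fun h => absurd h hz⟩
  choose W hW using hex
  have hdiff : DifferentiableOn ℂ W {z | 2 * c < z.im} :=
    differentiableOn_of_reciprocalCauchyTransform_eq hc hvar hμ
      (isOpen_lt continuous_const Complex.continuous_im) (fun z hz => (hW z hz).1.le)
      fun z hz => (hW z hz).2
  have hbound (z : ℂ) (hz : z ∈ cone α (2 * c)) : ‖W z - z‖ ≤ |μ[id]| + c / 8 := by
    simpa [selfEnergy, (hW z hz.1).2] using norm_selfEnergy_le hc hvar hμ (hW z hz.1).1.le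
  refine ⟨fun z => W z - z, ⟨?_, fun z hz => ?_, fun z hz => ?_, ?_⟩, fun z hz => ?_⟩
  · exact (hdiff.mono fun z hz => hz.1).sub differentiableOn_id
  · simpa using hc.trans (hW z hz.1).1
  · simpa using (hW z hz.1).2
  · exact tendsto_div_of_forall_norm_le hbound
  · simpa using (hW z hz.1).1

end FiniteVariance

lemma one_lt_norm_of_mem_cone {α β : ℝ} (hβ : 1 ≤ β) {z : ℂ} (hz : z ∈ cone α β) : 1 < ‖z‖ :=
  (hβ.trans_lt hz.1).trans_le ((le_abs_self _).trans (Complex.abs_im_le_norm z))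

theorem isVoiculescuTransform_semicircle {α β : ℝ} (hβ : 1 ≤ β) :
    IsVoiculescuTransform semicircle α β fun z => z⁻¹ where
  differentiableOn z hz := by
    have := one_lt_norm_of_mem_cone hβ hz
    exact (differentiableAt_inv (norm_pos_iff.1 (by linarith))).differentiableWithinAt
  im_pos z hz := (im_pos_iff_im_add_inv_pos (one_lt_norm_of_mem_cone hβ hz)).1
    (zero_lt_one.trans (hβ.trans_lt hz.1))
  right_inverse z hz := by
    rw [reciprocalCauchyTransform, cauchyTransform_semicircle (one_lt_norm_of_mem_cone hβ hz)
      (zero_lt_one.trans (hβ.trans_lt hz.1)), inv_inv]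
  tendsto := tendsto_div_of_forall_norm_le (C := 1) fun z hz => by
    rw [norm_inv]
    exact inv_le_one_of_one_le₀ (one_lt_norm_of_mem_cone hβ hz).le

lemma IsVoiculescuTransform.cauchyTransform_add {μ : Measure ℝ} {α β : ℝ} {φ : ℂ → ℂ}
    (hφ : IsVoiculescuTransform μ α β φ) {z : ℂ} (hz : z ∈ cone α β) :
    cauchyTransform μ (z + φ z) = z⁻¹ :=
  inv_eq_iff_eq_inv.1 (hφ.right_inverse z hz)

/-! ### Free convolution with the semicircle law -/

theorem IsPasturSolution.isFreeConvolution_semicircle {ν ρ : Measure ℝ} [IsProbabilityMeasure ν]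
    [IsProbabilityMeasure ρ] (h : IsPasturSolution ν ρ) (hν : MemLp id 2 ν) :
    IsFreeConvolution semicircle ν ρ := by
  have hvar := variance_nonneg id ν
  let c := 2 + 8 * Var[id; ν]
  have : 2 ≤ c := by
    simp only [c]
    linarith
  obtain ⟨φ, hφ, him⟩ :=
    exists_isVoiculescuTransform (c := c) (by linarith) (by nlinarith) hν 1
  have hsc : IsVoiculescuTransform semicircle 1 (2 * c) fun z => z⁻¹ :=
    isVoiculescuTransform_semicircle (by linarith)
  have hv (z : ℂ) (hz : z ∈ cone 1 (2 * c)) : 1 < (z + (z⁻¹ + φ z)).im := by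
    have hinv : ‖z⁻¹‖ ≤ 1 := by
      rw [norm_inv]
      exact inv_le_one_of_one_le₀ (one_lt_norm_of_mem_cone (by linarith) hz).le
    have hinv_im := (neg_le_abs _).trans ((Complex.abs_im_le_norm _).trans hinv)
    have hφz := him z hz
    simp only [Complex.add_im] at hφz ⊢
    linarith
  have hG (z : ℂ) (hz : z ∈ cone 1 (2 * c)) : cauchyTransform ρ (z + (z⁻¹ + φ z)) = z⁻¹ := by
    have hsub : z + (z⁻¹ + φ z) - z⁻¹ = z + φ z := by ring
    refine eq_of_eq_cauchyTransform_sub ν (h _ (hv z hz)) ?_ ?_ ?_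
    · rw [hsub, hφ.cauchyTransform_add hz]
    · exact (hv z hz).trans_le (im_le_im_sub_cauchyTransform ρ (zero_lt_one.trans (hv z hz)))
    · rw [hsub]
      linarith [him z hz]
  refine ⟨1, 2 * c, one_pos, by linarith, fun z => z⁻¹, φ, hsc, hφ,
    hsc.differentiableOn.add hφ.differentiableOn, fun z hz => zero_lt_one.trans (hv z hz),
    fun z hz => by rw [reciprocalCauchyTransform, hG z hz, inv_inv], ?_⟩
  simpa [add_div] using hsc.tendsto.add hφ.tendsto

lemma isOpen_cone (α β : ℝ) : IsOpen (cone α β) :=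
  (isOpen_lt continuous_const Complex.continuous_im).inter
    (isOpen_lt (continuous_abs.comp Complex.continuous_re)
      (continuous_const.mul Complex.continuous_im))

lemma eventually_mul_I_mem_cone {α : ℝ} (hα : 0 < α) (β : ℝ) :
    ∀ᶠ y : ℝ in atTop, (y * Complex.I : ℂ) ∈ cone α β := by
  filter_upwards [eventually_gt_atTop 0, eventually_gt_atTop β] with y hy hyβ
  exact ⟨by simpa using hyβ, by simpa using mul_pos hα hy⟩

lemma IsVoiculescuTransform.exists_lt_im_add {μ : Measure ℝ} {α β : ℝ} {φ : ℂ → ℂ}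
    (hφ : IsVoiculescuTransform μ α β φ) (hα : 0 < α) (b : ℝ) :
    ∃ z ∈ cone α β, b < (z + φ z).im := by
  have hray : Tendsto (fun y : ℝ => (y * Complex.I : ℂ)) atTop (cobounded ℂ ⊓ 𝓟 (cone α β)) := by
    refine tendsto_inf.2 ⟨?_, tendsto_principal.2 (eventually_mul_I_mem_cone hα β)⟩
    rw [← tendsto_norm_atTop_iff_cobounded]
    simpa using tendsto_abs_atTop_atTop
  have hsmall := (hφ.tendsto.comp hray).norm.eventually_lt_const
    (by simp : ‖(0 : ℂ)‖ < 1 / 2)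
  obtain ⟨y, hy, hymem, hyb, hy0⟩ := (hsmall.and ((eventually_mul_I_mem_cone hα β).and
    ((eventually_gt_atTop (2 * b)).and (eventually_gt_atTop 0)))).exists
  refine ⟨y * Complex.I, hymem, ?_⟩
  rw [Function.comp_apply, norm_div, norm_mul, Complex.norm_I, Complex.norm_of_nonneg hy0.le,
    mul_one, div_lt_iff₀ hy0] at hy
  have him := (neg_le_abs _).trans_lt ((Complex.abs_im_le_norm _).trans_lt hy)
  simp only [Complex.add_im, Complex.mul_im, Complex.ofReal_re, Complex.I_im, mul_one,
    Complex.ofReal_im, zero_mul, add_zero]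
  linarith

lemma IsVoiculescuTransform.tendsto_add_nhdsNE {μ : Measure ℝ} {α β : ℝ} {φ : ℂ → ℂ}
    (hφ : IsVoiculescuTransform μ α β φ) {z₀ : ℂ} (hz₀ : z₀ ∈ cone α β) :
    Tendsto (fun z => z + φ z) (𝓝[≠] z₀) (𝓝[≠] (z₀ + φ z₀)) := by
  have hnhds := (isOpen_cone α β).mem_nhds hz₀
  have hcont : ContinuousAt (fun z => z + φ z) z₀ :=
    continuousAt_id.add (hφ.differentiableOn.differentiableAt hnhds).continuousAt
  refine tendsto_nhdsWithin_iff.2 ⟨hcont.tendsto.mono_left nhdsWithin_le_nhds, ?_⟩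
  filter_upwards [nhdsWithin_le_nhds hnhds, self_mem_nhdsWithin] with z hz hne heq
  refine hne ?_
  rw [Set.mem_singleton_iff, ← hφ.right_inverse z hz, Set.mem_singleton_iff.1 heq,
    hφ.right_inverse z₀ hz₀]

theorem IsPasturSolution.eq_of_isFreeConvolution_semicircle {ν ρ ρ' : Measure ℝ}
    [IsProbabilityMeasure ν] [IsProbabilityMeasure ρ] [IsProbabilityMeasure ρ']
    (h : IsPasturSolution ν ρ) (h' : IsFreeConvolution semicircle ν ρ') : ρ' = ρ := by
  obtain ⟨α, β, hα, -, φ, ψ, hφ, hψ, hρ'⟩ := h'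
  have hfix (z : ℂ) (hz : z ∈ cone α β) : cauchyTransform ρ' (z + (φ z + ψ z)) =
      cauchyTransform ν (z + (φ z + ψ z) - cauchyTransform ρ' (z + (φ z + ψ z))) := by
    have hφz := eq_add_inv_of_cauchyTransform_semicircle (hφ.im_pos z hz)
      (hφ.cauchyTransform_add hz)
    have hsub : z + (φ z + ψ z) - z⁻¹ = z + ψ z := by linear_combination hφz
    rw [hρ'.cauchyTransform_add hz, hsub, hψ.cauchyTransform_add hz]
  obtain ⟨z₀, hz₀, him⟩ := hρ'.exists_lt_im_add hα 1
  have hnear : ∀ᶠ z in 𝓝[≠] z₀, z ∈ cone α β :=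
    nhdsWithin_le_nhds ((isOpen_cone α β).mem_nhds hz₀)
  exact h.eq_of_frequently him
    ((hρ'.tendsto_add_nhdsNE hz₀).frequently (hnear.mono hfix).frequently)

/-! ### Moments and the expansion of the Cauchy transform at infinity -/

/-- The Cauchy transform of the signed measure `x ^ n dμ(x)`. -/
noncomputable def powCauchyTransform (μ : Measure ℝ) (n : ℕ) (z : ℂ) : ℂ :=
  ∫ x : ℝ, (x : ℂ) ^ n * (z - x)⁻¹ ∂μ

lemma powCauchyTransform_zero (μ : Measure ℝ) : powCauchyTransform μ 0 = cauchyTransform μ := by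
  ext z
  simp [powCauchyTransform, cauchyTransform]

lemma tendsto_inv_mul_I : Tendsto (fun y : ℝ => (y * Complex.I)⁻¹) atTop (𝓝 0) :=
  squeeze_zero_norm (fun y => by simp) tendsto_abs_atTop_atTop.inv_tendsto_atTop

section powCauchyTransform

variable {μ : Measure ℝ} {n : ℕ} {z : ℂ}

lemma integrable_pow_of_le [IsFiniteMeasure μ] {m : ℕ} (hmn : m ≤ n)
    (hn : Integrable (fun x : ℝ => x ^ n) μ) : Integrable (fun x : ℝ => x ^ m) μ := by
  have h : Integrable (fun x : ℝ => ‖x‖ ^ n) μ := by simpa only [norm_pow] using hn.norm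
  refine (integrable_norm_iff (by fun_prop)).1 ?_
  simpa only [norm_pow, id_eq] using integrable_norm_pow_of_le aestronglyMeasurable_id hmn h

lemma integrable_ofReal_pow (hn : Integrable (fun x : ℝ => x ^ n) μ) :
    Integrable (fun x : ℝ => (x : ℂ) ^ n) μ := by
  simpa only [Complex.coe_algebraMap, Complex.ofReal_pow] using hn.ofReal (𝕜 := ℂ)

lemma integral_ofReal_pow (μ : Measure ℝ) (n : ℕ) :
    ∫ x : ℝ, (x : ℂ) ^ n ∂μ = ((∫ x, x ^ n ∂μ : ℝ) : ℂ) := by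
  simp only [← integral_complex_ofReal, Complex.ofReal_pow]

lemma integrable_pow_mul_inv_sub (hn : Integrable (fun x : ℝ => x ^ n) μ) (hz : 0 < z.im) :
    Integrable (fun x : ℝ => (x : ℂ) ^ n * (z - x)⁻¹) μ :=
  (integrable_ofReal_pow hn).mul_bdd (continuous_inv_sub_ofReal hz).aestronglyMeasurable
    (.of_forall (norm_inv_sub_ofReal_le hz))

lemma norm_powCauchyTransform_le (hn : Integrable (fun x : ℝ => x ^ n) μ) (hz : 0 < z.im) :
    ‖powCauchyTransform μ n z‖ ≤ (∫ x, ‖x ^ n‖ ∂μ) * z.im⁻¹ := by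
  rw [← integral_mul_const]
  refine norm_integral_le_of_norm_le (hn.norm.mul_const _) (.of_forall fun x => ?_)
  rw [norm_mul, ← Complex.ofReal_pow, Complex.norm_real]
  exact mul_le_mul_of_nonneg_left (norm_inv_sub_ofReal_le hz x) (norm_nonneg _)

lemma mul_powCauchyTransform [IsFiniteMeasure μ] (hn : Integrable (fun x : ℝ => x ^ (n + 1)) μ)
    (hz : 0 < z.im) :
    z * powCauchyTransform μ n z = (∫ x, x ^ n ∂μ : ℝ) + powCauchyTransform μ (n + 1) z := by
  rw [powCauchyTransform, powCauchyTransform, ← integral_ofReal_pow, ← integral_const_mul,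
    ← integral_add (integrable_ofReal_pow (integrable_pow_of_le n.le_succ hn))
      (integrable_pow_mul_inv_sub hn hz)]
  refine integral_congr_ae (.of_forall fun x => ?_)
  have := sub_ofReal_ne_zero hz x
  simp only
  field_simp
  ring

lemma cauchyTransform_eq_sum_add [IsFiniteMeasure μ] (hn : Integrable (fun x : ℝ => x ^ n) μ)
    (hz : 0 < z.im) :
    cauchyTransform μ z = ∑ j ∈ Finset.range n, ((∫ x, x ^ j ∂μ : ℝ) : ℂ) * z⁻¹ ^ (j + 1) +
      z⁻¹ ^ n * powCauchyTransform μ n z := by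
  have hz0 : z ≠ 0 := by
    rintro rfl
    exact lt_irrefl _ hz
  induction n with
  | zero => simp [powCauchyTransform_zero]
  | succ n ih =>
    have hrec := mul_powCauchyTransform hn hz
    rw [← eq_inv_mul_iff_mul_eq₀ hz0] at hrec
    rw [ih (integrable_pow_of_le n.le_succ hn), Finset.sum_range_succ, hrec]
    ring

lemma norm_mul_I_mul_inv_sub_le {y : ℝ} (hy : 0 < y) (x : ℝ) :
    ‖y * Complex.I * (y * Complex.I - x)⁻¹‖ ≤ 1 := by
  have h := norm_inv_sub_ofReal_le (z := y * Complex.I) (by simpa) x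
  rw [Complex.im_ofReal_mul, Complex.I_im, mul_one] at h
  rw [norm_mul, norm_mul, Complex.norm_I, mul_one, Complex.norm_of_nonneg hy.le]
  exact (mul_le_mul_of_nonneg_left h hy.le).trans (mul_inv_cancel₀ hy.ne').le

lemma tendsto_mul_I_mul_inv_sub (x : ℝ) :
    Tendsto (fun y : ℝ => y * Complex.I * (y * Complex.I - x)⁻¹) atTop (𝓝 1) := by
  have h : Tendsto (fun y : ℝ => (1 - x * (y * Complex.I)⁻¹)⁻¹) atTop (𝓝 (1 - x * 0)⁻¹) :=
    (tendsto_const_nhds.sub (tendsto_inv_mul_I.const_mul _)).inv₀ (by simp)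
  rw [mul_zero, sub_zero, inv_one] at h
  refine h.congr' ((eventually_ne_atTop 0).mono fun y hy => ?_)
  have hy' : (y : ℂ) * Complex.I ≠ 0 := by simpa
  have hsub : 1 - x * (y * Complex.I)⁻¹ = (y * Complex.I)⁻¹ * (y * Complex.I - x) := by
    rw [mul_sub, inv_mul_cancel₀ hy', mul_comm (x : ℂ)]
  rw [hsub, mul_inv, inv_inv]

lemma tendsto_mul_I_mul_powCauchyTransform (hn : Integrable (fun x : ℝ => x ^ n) μ) :
    Tendsto (fun y : ℝ => y * Complex.I * powCauchyTransform μ n (y * Complex.I)) atTop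
      (𝓝 (∫ x, x ^ n ∂μ : ℝ)) := by
  simp only [powCauchyTransform, ← integral_const_mul, ← integral_ofReal_pow,
    mul_left_comm _ (_ ^ n)]
  refine tendsto_integral_filter_of_dominated_convergence (fun x => ‖x ^ n‖) ?_ ?_ hn.norm
    (.of_forall fun x => by simpa using (tendsto_mul_I_mul_inv_sub x).const_mul ((x : ℂ) ^ n))
  · filter_upwards [eventually_gt_atTop 0] with y hy
    simpa only [mul_left_comm] using ((integrable_pow_mul_inv_sub hn
      (z := y * Complex.I) (by simpa)).const_mul (y * Complex.I)).aestronglyMeasurable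
  · filter_upwards [eventually_gt_atTop 0] with y hy
    refine .of_forall fun x => ?_
    rw [norm_mul, ← Complex.ofReal_pow, Complex.norm_real]
    exact mul_le_of_le_one_right (norm_nonneg _) (norm_mul_I_mul_inv_sub_le hy x)

lemma pow_sub_re_mul_I_mul_pow_mul_inv_sub (n : ℕ) {y : ℝ} (hy : 0 < y) (x : ℝ) :
    x ^ n - (y * Complex.I * ((x : ℂ) ^ n * (y * Complex.I - x)⁻¹)).re =
      x ^ n * (x ^ 2 / (x ^ 2 + y ^ 2)) := by
  rw [← one_sub_re_mul_I_mul_inv_sub hy, mul_left_comm, ← Complex.ofReal_pow,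
    Complex.re_ofReal_mul, Complex.sub_re, Complex.one_re]
  ring

lemma integrable_pow_mul_sq_div_sq_add_sq (hn : Integrable (fun x : ℝ => x ^ n) μ) {y : ℝ}
    (hy : 0 < y) : Integrable (fun x => x ^ n * (x ^ 2 / (x ^ 2 + y ^ 2))) μ := by
  simp only [← pow_sub_re_mul_I_mul_pow_mul_inv_sub n hy]
  exact hn.sub ((integrable_pow_mul_inv_sub hn (by simpa)).const_mul _).re

lemma integral_pow_sub_re_mul_I_mul_powCauchyTransform (hn : Integrable (fun x : ℝ => x ^ n) μ)
    {y : ℝ} (hy : 0 < y) :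
    ∫ x, x ^ n ∂μ - (y * Complex.I * powCauchyTransform μ n (y * Complex.I)).re =
      ∫ x, x ^ n * (x ^ 2 / (x ^ 2 + y ^ 2)) ∂μ := by
  have hint := (integrable_pow_mul_inv_sub hn (z := y * Complex.I) (by simpa)).const_mul
    (y * Complex.I)
  simp only [← pow_sub_re_mul_I_mul_pow_mul_inv_sub n hy]
  rw [powCauchyTransform, ← integral_const_mul]
  exact (congrArg _ (integral_re hint).symm).trans (integral_sub hn hint.re).symm

lemma tendsto_pow_mul_div_sq_add_sq (x : ℝ) (n : ℕ) :
    Tendsto (fun y : ℝ => y ^ 2 * (x ^ n * (x ^ 2 / (x ^ 2 + y ^ 2)))) atTop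
      (𝓝 (x ^ (n + 2))) := by
  have h : Tendsto (fun y : ℝ => x ^ (n + 2) * (x ^ 2 * (y ^ 2)⁻¹ + 1)⁻¹) atTop
      (𝓝 (x ^ (n + 2) * (x ^ 2 * 0 + 1)⁻¹)) :=
    ((((tendsto_pow_atTop two_ne_zero).inv_tendsto_atTop.const_mul _).add_const 1).inv₀
      (by simp)).const_mul _
  simp only [mul_zero, zero_add, inv_one, mul_one] at h
  refine h.congr' ((eventually_gt_atTop 0).mono fun y hy => ?_)
  have : x ^ 2 + y ^ 2 ≠ 0 := by positivity
  field_simp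
  ring

theorem integrable_pow_add_two_of_isBigO (heven : Even n) (hn : Integrable (fun x : ℝ => x ^ n) μ)
    (h : (fun y : ℝ => ∫ x, x ^ n ∂μ -
      (y * Complex.I * powCauchyTransform μ n (y * Complex.I)).re) =O[atTop]
        fun y : ℝ => y⁻¹ ^ 2) :
    Integrable (fun x : ℝ => x ^ (n + 2)) μ := by
  obtain ⟨C, hC⟩ := h.bound
  have hbound : ∀ᶠ k : ℕ in atTop,
      ∫⁻ x, ‖(k : ℝ) ^ 2 * (x ^ n * (x ^ 2 / (x ^ 2 + (k : ℝ) ^ 2)))‖ₑ ∂μ ≤ ENNReal.ofReal C := by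
    filter_upwards [tendsto_natCast_atTop_atTop.eventually (hC.and (eventually_gt_atTop 0))]
      with k ⟨hk, hk0⟩
    have hnonneg (x : ℝ) : 0 ≤ (k : ℝ) ^ 2 * (x ^ n * (x ^ 2 / (x ^ 2 + (k : ℝ) ^ 2))) := by
      have := heven.pow_nonneg x
      positivity
    rw [integral_pow_sub_re_mul_I_mul_powCauchyTransform hn hk0, norm_pow, norm_inv,
      Real.norm_of_nonneg hk0.le, inv_pow, ← div_eq_mul_inv, le_div_iff₀' (by positivity)] at hk
    simp only [Real.enorm_of_nonneg (hnonneg _)]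
    rw [← ofReal_integral_eq_lintegral_ofReal
      ((integrable_pow_mul_sq_div_sq_add_sq hn hk0).const_mul _) (.of_forall hnonneg),
      integral_const_mul]
    exact ENNReal.ofReal_le_ofReal
      ((mul_le_mul_of_nonneg_left (le_abs_self _) (sq_nonneg _)).trans hk)
  refine integrable_of_tendsto (.of_forall fun x =>
      (tendsto_pow_mul_div_sq_add_sq x n).comp tendsto_natCast_atTop_atTop)
    (fun k => (by fun_prop : Measurable _).aestronglyMeasurable) (ne_top_of_le_ne_top
      ENNReal.ofReal_ne_top (liminf_le_of_frequently_le' hbound.frequently))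

end powCauchyTransform

/-- `f` has the asymptotic expansion `a` in powers of `1 / (i y)` as `y → ∞`, up to an error
`O(y ^ (-N))`. -/
def HasExpansion (f : ℝ → ℂ) (a : PowerSeries ℂ) (N : ℕ) : Prop :=
  (fun y : ℝ => f y - (PowerSeries.trunc N a).eval (y * Complex.I)⁻¹) =O[atTop]
    fun y : ℝ => y⁻¹ ^ N

lemma isBigO_inv_mul_I : (fun y : ℝ => (y * Complex.I)⁻¹) =O[atTop] fun y : ℝ => y⁻¹ :=
  .of_bound 1 (.of_forall fun y => by simp)

lemma isBigO_eval_one (p : Polynomial ℂ) :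
    (fun y : ℝ => p.eval (y * Complex.I)⁻¹) =O[atTop] fun _ => (1 : ℝ) :=
  ((p.continuous.tendsto 0).comp tendsto_inv_mul_I).isBigO_one ℝ

lemma isBigO_eval_of_coeff_eq_zero {p : Polynomial ℂ} {N : ℕ} (hp : ∀ d < N, p.coeff d = 0) :
    (fun y : ℝ => p.eval (y * Complex.I)⁻¹) =O[atTop] fun y : ℝ => y⁻¹ ^ N := by
  obtain ⟨q, rfl⟩ := Polynomial.X_pow_dvd_iff.2 hp
  simpa using (isBigO_inv_mul_I.pow N).mul (isBigO_eval_one q)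

namespace HasExpansion

variable {f g : ℝ → ℂ} {a b : PowerSeries ℂ} {N : ℕ}

lemma isBigO_one (hf : HasExpansion f a N) : f =O[atTop] fun _ => (1 : ℝ) := by
  have hpow : (fun y : ℝ => y⁻¹ ^ N) =O[atTop] fun _ => (1 : ℝ) :=
    (tendsto_inv_atTop_zero.pow N).isBigO_one ℝ
  simpa using (hf.trans hpow).add (isBigO_eval_one (PowerSeries.trunc N a))

lemma of_isBigO_one (hf : f =O[atTop] fun _ => (1 : ℝ)) : HasExpansion f a 0 := by
  simpa only [HasExpansion, PowerSeries.trunc_zero', Polynomial.eval_zero, sub_zero, pow_zero]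

lemma const (c : ℂ) (N : ℕ) : HasExpansion (fun _ => c) (PowerSeries.C c) N := by
  rcases N with _ | N
  · exact of_isBigO_one (Asymptotics.isBigO_const_const c one_ne_zero atTop)
  · simpa [HasExpansion] using Asymptotics.isBigO_zero _ _

lemma add (hf : HasExpansion f a N) (hg : HasExpansion g b N) :
    HasExpansion (fun y => f y + g y) (a + b) N := by
  refine (Asymptotics.IsBigO.add hf hg).congr_left fun y => ?_
  rw [map_add, Polynomial.eval_add]
  ring

lemma mul (hf : HasExpansion f a N) (hg : HasExpansion g b N) :
    HasExpansion (fun y => f y * g y) (a * b) N := by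
  have hleft : (fun y => f y * (g y - (PowerSeries.trunc N b).eval (y * Complex.I)⁻¹)) =O[atTop]
      fun y : ℝ => y⁻¹ ^ N := by
    simpa using hf.isBigO_one.mul hg
  have hright : (fun y => (f y - (PowerSeries.trunc N a).eval (y * Complex.I)⁻¹) *
      (PowerSeries.trunc N b).eval (y * Complex.I)⁻¹) =O[atTop] fun y : ℝ => y⁻¹ ^ N := by
    simpa using Asymptotics.IsBigO.mul hf (isBigO_eval_one (PowerSeries.trunc N b))
  have htail := isBigO_eval_of_coeff_eq_zero (N := N)
    (p := PowerSeries.trunc N a * PowerSeries.trunc N b - PowerSeries.trunc N (a * b))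
    fun d hd => by
      rw [Polynomial.coeff_sub, PowerSeries.coeff_trunc, if_pos hd, sub_eq_zero,
        PowerSeries.coeff_mul_eq_coeff_trunc_mul_trunc a b hd, ← Polynomial.coe_mul,
        Polynomial.coeff_coe]
  refine ((hleft.add hright).add htail).congr_left fun y => ?_
  rw [Polynomial.eval_sub, Polynomial.eval_mul]
  ring

lemma inv_mul (hf : HasExpansion f a N) :
    HasExpansion (fun y => (y * Complex.I)⁻¹ * f y) (PowerSeries.X * a) (N + 1) := by
  have htrunc : PowerSeries.trunc (N + 1) (PowerSeries.X * a) =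
      Polynomial.X * PowerSeries.trunc N a := by
    ext (_ | d)
    · simp [PowerSeries.coeff_trunc]
    · simp [PowerSeries.coeff_trunc, PowerSeries.coeff_succ_X_mul]
  refine (isBigO_inv_mul_I.mul hf).congr (fun y => ?_) fun y => (pow_succ' _ _).symm
  rw [htrunc, Polynomial.eval_mul, Polynomial.eval_X]
  ring

lemma congr' (hf : HasExpansion f a N) (h : f =ᶠ[atTop] g) : HasExpansion g a N :=
  Asymptotics.IsBigO.congr' hf (h.mono fun y hy => by simp only [hy]) .rfl

end HasExpansion

/-- The formal Cauchy transform `∑ c n / z ^ (n + 1)` of a moment sequence, as a power series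
in `1 / z`. -/
noncomputable def cauchySeries (c : ℕ → ℝ) : PowerSeries ℂ :=
  PowerSeries.X * PowerSeries.mk fun n => (c n : ℂ)

lemma eval_trunc_cauchySeries (c : ℕ → ℝ) (N : ℕ) (w : ℂ) :
    (PowerSeries.trunc (N + 1) (cauchySeries c)).eval w =
      ∑ j ∈ Finset.range N, (c j : ℂ) * w ^ (j + 1) := by
  rw [Polynomial.eval, PowerSeries.eval₂_trunc_eq_sum_range, Finset.sum_range_succ']
  simp [cauchySeries, PowerSeries.coeff_succ_X_mul]

section HamburgerNevanlinna

variable {μ : Measure ℝ} [IsFiniteMeasure μ] {c : ℕ → ℝ} {n : ℕ}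

lemma isBigO_mul_I_mul_powCauchyTransform_sub
    (h : HasExpansion (fun y => cauchyTransform μ (y * Complex.I)) (cauchySeries c) (n + 3))
    (hn : Integrable (fun x : ℝ => x ^ n) μ) (hc : ∀ j < n, ∫ x, x ^ j ∂μ = c j) :
    (fun y : ℝ => y * Complex.I * powCauchyTransform μ n (y * Complex.I) -
      (c n + c (n + 1) * (y * Complex.I)⁻¹)) =O[atTop] fun y : ℝ => y⁻¹ ^ 2 := by
  have hpow : (fun y : ℝ => (y * Complex.I) ^ (n + 1)) =O[atTop] fun y : ℝ => y ^ (n + 1) :=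
    .of_bound 1 (.of_forall fun y => by simp)
  refine (hpow.mul h).congr' ?_ ?_
  · filter_upwards [eventually_gt_atTop 0] with y hy
    have hz : (y : ℂ) * Complex.I ≠ 0 := by simpa using hy.ne'
    rw [eval_trunc_cauchySeries, cauchyTransform_eq_sum_add hn (by simpa), Finset.sum_range_succ,
      Finset.sum_range_succ,
      Finset.sum_congr rfl fun j hj => by rw [hc j (Finset.mem_range.1 hj)]]
    generalize (y : ℂ) * Complex.I = z at hz ⊢
    generalize ∑ j ∈ Finset.range n, (c j : ℂ) * z⁻¹ ^ (j + 1) = S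
    have hcancel (k : ℕ) : z ^ k * z⁻¹ ^ k = 1 := by rw [← mul_pow, mul_inv_cancel₀ hz, one_pow]
    linear_combination (z * powCauchyTransform μ n z) * hcancel n -
      (c n + c (n + 1) * z⁻¹) * hcancel (n + 1)
  · filter_upwards [eventually_ne_atTop 0] with y hy
    rw [add_assoc n 1 2, ← add_assoc, pow_add y⁻¹, ← mul_assoc, ← mul_pow, mul_inv_cancel₀ hy,
      one_pow, one_mul]

lemma integral_pow_eq_of_hasExpansion
    (h : HasExpansion (fun y => cauchyTransform μ (y * Complex.I)) (cauchySeries c) (n + 3))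
    (hn : Integrable (fun x : ℝ => x ^ n) μ) (hc : ∀ j < n, ∫ x, x ^ j ∂μ = c j) :
    ∫ x, x ^ n ∂μ = c n := by
  have herror := (isBigO_mul_I_mul_powCauchyTransform_sub h hn hc).trans_tendsto
    (by simpa using (tendsto_inv_atTop_zero (𝕜 := ℝ)).pow 2)
  have hlim := herror.add ((tendsto_inv_mul_I.const_mul (c (n + 1) : ℂ)).const_add (c n : ℂ))
  simp only [sub_add_cancel, mul_zero, add_zero, zero_add] at hlim
  exact_mod_cast tendsto_nhds_unique (tendsto_mul_I_mul_powCauchyTransform hn) hlim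

lemma integrable_pow_add_two_of_hasExpansion (heven : Even n)
    (h : HasExpansion (fun y => cauchyTransform μ (y * Complex.I)) (cauchySeries c) (n + 3))
    (hn : Integrable (fun x : ℝ => x ^ n) μ) (hc : ∀ j < n, ∫ x, x ^ j ∂μ = c j) :
    Integrable (fun x : ℝ => x ^ (n + 2)) μ := by
  -- The `1 / (i y)` term of the expansion is purely imaginary.
  refine integrable_pow_add_two_of_isBigO heven hn (.trans (.of_bound 1 (.of_forall fun y => ?_))
    (isBigO_mul_I_mul_powCauchyTransform_sub h hn hc))
  have hre : ∫ x, x ^ n ∂μ - (y * Complex.I * powCauchyTransform μ n (y * Complex.I)).re =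
      -(y * Complex.I * powCauchyTransform μ n (y * Complex.I) -
        (c n + c (n + 1) * (y * Complex.I)⁻¹)).re := by
    simp [integral_pow_eq_of_hasExpansion h hn hc]
  rw [hre, norm_neg, one_mul]
  exact Complex.abs_re_le_norm _

/-- **Hamburger–Nevanlinna theorem**. -/
theorem integral_pow_of_forall_hasExpansion
    (h : ∀ N, HasExpansion (fun y => cauchyTransform μ (y * Complex.I)) (cauchySeries c) N)
    (n : ℕ) : Integrable (fun x : ℝ => x ^ n) μ ∧ ∫ x, x ^ n ∂μ = c n := by
  have hlt {m : ℕ} (hm : Integrable (fun x : ℝ => x ^ m) μ) :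
      ∀ j < m + 1, ∫ x, x ^ j ∂μ = c j := by
    intro j hj
    induction j using Nat.strong_induction_on with
    | _ j ih =>
      exact integral_pow_eq_of_hasExpansion (h _) (integrable_pow_of_le (by omega) hm)
        fun i hi => ih i hi (hi.trans hj)
  have heven (k : ℕ) : Integrable (fun x : ℝ => x ^ (2 * k)) μ := by
    induction k with
    | zero => simp
    | succ k ih =>
      exact integrable_pow_add_two_of_hasExpansion (even_two_mul k) (h _) ih
        fun j hj => hlt ih j (hj.trans (Nat.lt_succ_self _))
  have hn := integrable_pow_of_le (by omega : n ≤ 2 * n) (heven n)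
  exact ⟨hn, hlt hn n n.lt_succ_self⟩

end HamburgerNevanlinna

/-! ### Moments of solutions of Pastur's equation -/

/-- The recursion satisfied by the coefficients `d b n` of `1 / z ^ (n + 1)` in the expansions of
`∫ x ^ b / (z - G_ρ z - x) dν(x)`, where `ρ` solves Pastur's equation for a measure `ν` with
moments `m`. -/
structure IsPasturRecursion (m : ℕ → ℝ) (d : ℕ → ℕ → ℝ) : Prop where
  apply_zero (b : ℕ) : d b 0 = m b
  apply_one (b : ℕ) : d b 1 = d (b + 1) 0
  apply_add_two (b n : ℕ) :
    d b (n + 2) = d (b + 1) (n + 1) + ∑ i ∈ Finset.range (n + 1), d 0 i * d b (n - i)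

lemma IsPasturRecursion.cauchySeries_eq {m : ℕ → ℝ} {d : ℕ → ℕ → ℝ} (hd : IsPasturRecursion m d)
    (b : ℕ) :
    cauchySeries (d b) = PowerSeries.X * (PowerSeries.C (m b : ℂ) + cauchySeries (d (b + 1)) +
      cauchySeries (d 0) * cauchySeries (d b)) := by
  simp only [cauchySeries]
  congr 1
  ext n
  rw [mul_assoc PowerSeries.X, mul_left_comm _ PowerSeries.X]
  rcases n with _ | _ | n
  · simp [hd.apply_zero]
  · simp [PowerSeries.coeff_succ_X_mul, hd.apply_one]
  · rw [map_add, map_add, PowerSeries.coeff_succ_X_mul, PowerSeries.coeff_succ_X_mul,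
      PowerSeries.coeff_succ_X_mul, PowerSeries.coeff_mul,
      Finset.Nat.sum_antidiagonal_eq_sum_range_succ_mk]
    simp [hd.apply_add_two]

section

variable {ν ρ : Measure ℝ} [IsFiniteMeasure ν] [IsFiniteMeasure ρ]

lemma inv_mul_add_eq_powCauchyTransform (hν : ∀ b : ℕ, Integrable (fun x : ℝ => x ^ b) ν)
    (h : IsPasturSolution ν ρ) (b : ℕ) {z : ℂ} (hz : 1 < z.im) :
    z⁻¹ * ((∫ x, x ^ b ∂ν : ℝ) + powCauchyTransform ν (b + 1) (z - cauchyTransform ρ z) +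
      powCauchyTransform ν 0 (z - cauchyTransform ρ z) *
        powCauchyTransform ν b (z - cauchyTransform ρ z)) =
      powCauchyTransform ν b (z - cauchyTransform ρ z) := by
  have hz0 : z ≠ 0 := by
    rintro rfl
    exact zero_lt_one.not_gt hz
  have hw := (zero_lt_one.trans hz).trans_le
    (im_le_im_sub_cauchyTransform ρ (zero_lt_one.trans hz))
  rw [inv_mul_eq_iff_eq_mul₀ hz0, powCauchyTransform_zero, ← h z hz,
    ← mul_powCauchyTransform (hν _) hw]
  ring

theorem IsPasturSolution.hasExpansion_powCauchyTransform (h : IsPasturSolution ν ρ)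
    (hν : ∀ b : ℕ, Integrable (fun x : ℝ => x ^ b) ν) {d : ℕ → ℕ → ℝ}
    (hd : IsPasturRecursion (fun b => ∫ x, x ^ b ∂ν) d) (N b : ℕ) :
    HasExpansion
      (fun y => powCauchyTransform ν b (y * Complex.I - cauchyTransform ρ (y * Complex.I)))
      (cauchySeries (d b)) N := by
  induction N generalizing b with
  | zero =>
    refine .of_isBigO_one (.of_bound (∫ x, ‖x ^ b‖ ∂ν) ?_)
    filter_upwards [eventually_gt_atTop 1] with y hy
    have hw : 1 ≤ (y * Complex.I - cauchyTransform ρ (y * Complex.I)).im := by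
      have := im_le_im_sub_cauchyTransform ρ (z := y * Complex.I) (by simp; linarith)
      rw [Complex.im_ofReal_mul, Complex.I_im, mul_one] at this
      linarith
    rw [norm_one]
    exact (norm_powCauchyTransform_le (hν b) (zero_lt_one.trans_le hw)).trans
      (mul_le_mul_of_nonneg_left (inv_le_one_of_one_le₀ hw) (by positivity))
  | succ N ih =>
    rw [hd.cauchySeries_eq]
    refine (((HasExpansion.const _ N).add (ih (b + 1))).add ((ih 0).mul (ih b))).inv_mul.congr' ?_
    filter_upwards [eventually_gt_atTop 1] with y hy
    exact inv_mul_add_eq_powCauchyTransform hν h b (by simpa)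

theorem IsPasturSolution.integral_pow (h : IsPasturSolution ν ρ)
    (hν : ∀ b : ℕ, Integrable (fun x : ℝ => x ^ b) ν) {d : ℕ → ℕ → ℝ}
    (hd : IsPasturRecursion (fun b => ∫ x, x ^ b ∂ν) d) (n : ℕ) :
    Integrable (fun x : ℝ => x ^ n) ρ ∧ ∫ x, x ^ n ∂ρ = d 0 n := by
  refine integral_pow_of_forall_hasExpansion (fun N => ?_) n
  refine (h.hasExpansion_powCauchyTransform hν hd N 0).congr' ?_
  filter_upwards [eventually_gt_atTop 1] with y hy
  rw [powCauchyTransform_zero, ← h _ (by simpa)]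

end

/-! ### Determinacy of the moment problem -/

lemma ext_of_integral_pow_eq {μ ν : Measure ℝ} [IsFiniteMeasure μ] [IsFiniteMeasure ν]
    (hμ : 0 ∈ interior (integrableExpSet id μ)) (hν : 0 ∈ interior (integrableExpSet id ν))
    (h : ∀ n : ℕ, ∫ x, x ^ n ∂μ = ∫ x, x ^ n ∂ν) : μ = ν := by
  set I := interior (integrableExpSet id μ) ∩ interior (integrableExpSet id ν)
  have hstrip : IsPreconnected {z : ℂ | z.re ∈ I} :=
    ((convex_integrableExpSet.interior.inter convex_integrableExpSet.interior).linear_preimage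
      Complex.reLm).isPreconnected
  have hderiv (n : ℕ) :
      iteratedDeriv n (complexMGF id μ) 0 = iteratedDeriv n (complexMGF id ν) 0 := by
    rw [iteratedDeriv_complexMGF (by simpa using hμ), iteratedDeriv_complexMGF (by simpa using hν)]
    have := congrArg Complex.ofReal (h n)
    simpa [← integral_complex_ofReal] using this
  have hnear : complexMGF id μ =ᶠ[𝓝 0] complexMGF id ν := by
    have hμ0 := (analyticAt_complexMGF (z := 0) (by simpa using hμ)).hasFPowerSeriesAt
    have hν0 := (analyticAt_complexMGF (z := 0) (by simpa using hν)).hasFPowerSeriesAt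
    simp only [hderiv] at hμ0
    filter_upwards [hμ0.eventually_hasSum_sub, hν0.eventually_hasSum_sub] with z h₁ h₂
      using h₁.unique h₂
  have heq : Set.EqOn (complexMGF id μ) (complexMGF id ν) {z | z.re ∈ I} :=
    (analyticOnNhd_complexMGF.mono fun z hz => hz.1).eqOn_of_preconnected_of_eventuallyEq
      (analyticOnNhd_complexMGF.mono fun z hz => hz.2) hstrip (z₀ := 0) ⟨by simpa, by simpa⟩ hnear
  refine Measure.ext_of_charFun (funext fun t => ?_)
  rw [← complexMGF_id_mul_I, ← complexMGF_id_mul_I]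
  exact heq ⟨by simpa, by simpa⟩

lemma lintegral_cosh_mul {μ : Measure ℝ} (hμ : ∀ k : ℕ, Integrable (fun x : ℝ => x ^ (2 * k)) μ)
    (t : ℝ) :
    ∫⁻ x, ENNReal.ofReal (Real.cosh (t * x)) ∂μ =
      ∑' k : ℕ, ENNReal.ofReal (t ^ (2 * k) / (2 * k).factorial * ∫ x, x ^ (2 * k) ∂μ) := by
  have hterm (k : ℕ) (x : ℝ) :
      (t * x) ^ (2 * k) / (2 * k).factorial = t ^ (2 * k) / (2 * k).factorial * x ^ (2 * k) := by
    ring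
  have hnonneg (k : ℕ) (x : ℝ) : 0 ≤ (t * x) ^ (2 * k) / (2 * k).factorial :=
    div_nonneg ((even_two_mul k).pow_nonneg _) (Nat.cast_nonneg _)
  have hcosh (x : ℝ) : ENNReal.ofReal (Real.cosh (t * x)) =
      ∑' k : ℕ, ENNReal.ofReal ((t * x) ^ (2 * k) / (2 * k).factorial) := by
    rw [Real.cosh_eq_tsum, ENNReal.ofReal_tsum_of_nonneg (fun k => hnonneg k x)
      (Real.hasSum_cosh _).summable]
  simp only [hcosh]
  rw [lintegral_tsum fun k => by fun_prop]
  refine tsum_congr fun k => ?_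
  have hint : Integrable (fun x => (t * x) ^ (2 * k) / (2 * k).factorial) μ := by
    simpa only [hterm] using (hμ k).const_mul _
  rw [← ofReal_integral_eq_lintegral_ofReal hint (.of_forall (hnonneg k)), ← integral_const_mul]
  simp only [hterm]

lemma integrable_exp_mul_of_integral_pow_le {μ ν : Measure ℝ} {c : ℝ}
    (hμ : ∀ k : ℕ, Integrable (fun x : ℝ => x ^ (2 * k)) μ)
    (hν : ∀ t, Integrable (fun x => Real.exp (t * x)) ν)
    (hle : ∀ k : ℕ, ∫ x, x ^ (2 * k) ∂μ ≤ c ^ (2 * k) * ∫ x, x ^ (2 * k) ∂ν) (t : ℝ) :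
    Integrable (fun x => Real.exp (t * x)) μ := by
  have hpow (k : ℕ) : Integrable (fun x : ℝ => x ^ (2 * k)) ν :=
    integrable_pow_of_integrable_exp_mul (X := id) one_ne_zero (hν 1) (hν (-1)) (2 * k)
  have hcosh (s : ℝ) : Integrable (fun x => Real.cosh (s * x)) ν := by
    simpa only [Real.cosh_eq, Pi.add_apply, neg_mul] using ((hν s).add (hν (-s))).div_const 2
  have hfin : ∫⁻ x, ENNReal.ofReal (Real.cosh (t * x)) ∂μ < ⊤ := by
    refine lt_of_le_of_lt ?_ (hcosh (c * t)).lintegral_lt_top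
    rw [lintegral_cosh_mul hμ, lintegral_cosh_mul hpow]
    refine ENNReal.tsum_le_tsum fun k => ENNReal.ofReal_le_ofReal ?_
    calc t ^ (2 * k) / (2 * k).factorial * ∫ x, x ^ (2 * k) ∂μ
        ≤ t ^ (2 * k) / (2 * k).factorial * (c ^ (2 * k) * ∫ x, x ^ (2 * k) ∂ν) :=
          mul_le_mul_of_nonneg_left (hle k)
            (div_nonneg ((even_two_mul k).pow_nonneg t) (Nat.cast_nonneg _))
      _ = (c * t) ^ (2 * k) / (2 * k).factorial * ∫ x, x ^ (2 * k) ∂ν := by ring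
  have hcoshμ : Integrable (fun x => Real.cosh (t * x)) μ :=
    (lintegral_ofReal_ne_top_iff_integrable (by fun_prop)
      (.of_forall fun x => (Real.cosh_pos _).le)).1 hfin.ne
  refine (hcoshμ.const_mul 2).mono' (by fun_prop) (.of_forall fun x => ?_)
  rw [Real.norm_of_nonneg (Real.exp_pos _).le, Real.cosh_eq]
  linarith [Real.exp_pos (-(t * x))]

lemma integral_pow_eq_zero_of_isSymmetric {ρ : Measure ℝ} (h : IsSymmetric ρ) {n : ℕ}
    (hn : Odd n) : ∫ x, x ^ n ∂ρ = 0 := by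
  have hneg : ∫ x, x ^ n ∂(ρ.map fun x => -x) = ∫ x, (-x) ^ n ∂ρ :=
    integral_map (by fun_prop) (by fun_prop)
  rw [show ρ.map (fun x => -x) = ρ from h] at hneg
  simp only [hn.neg_pow, integral_neg] at hneg
  linarith

lemma IsSymmetric.ext_of_integral_pow_eq {μ ν : Measure ℝ} [IsFiniteMeasure μ] [IsFiniteMeasure ν]
    (hμ : IsSymmetric μ) (hν : IsSymmetric ν) (hexp : ∀ t, Integrable (fun x => Real.exp (t * x)) ν)
    (hint : ∀ k : ℕ, Integrable (fun x : ℝ => x ^ (2 * k)) μ)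
    (h : ∀ k : ℕ, ∫ x, x ^ (2 * k) ∂μ = ∫ x, x ^ (2 * k) ∂ν) : μ = ν := by
  have hexpμ := integrable_exp_mul_of_integral_pow_le (c := 1) hint hexp fun k => by simp [h k]
  have hν_univ : integrableExpSet id ν = Set.univ := Set.eq_univ_of_forall hexp
  have hμ_univ : integrableExpSet id μ = Set.univ := Set.eq_univ_of_forall hexpμ
  refine FreeConv.ext_of_integral_pow_eq (by simp [hμ_univ]) (by simp [hν_univ]) fun n => ?_
  rcases n.even_or_odd' with ⟨k, rfl | rfl⟩
  · exact h k
  · have hodd := odd_two_mul_add_one k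
    rw [integral_pow_eq_zero_of_isSymmetric hμ hodd, integral_pow_eq_zero_of_isSymmetric hν hodd]

/-! ### Moments of Gaussian laws -/

lemma isSymmetric_gaussianReal (v : ℝ≥0) : IsSymmetric (gaussianReal 0 v) := by
  rw [IsSymmetric, gaussianReal_map_neg, neg_zero]

lemma integrable_pow_gaussianReal (m : ℝ) (v : ℝ≥0) (n : ℕ) :
    Integrable (fun x : ℝ => x ^ n) (gaussianReal m v) :=
  integrable_pow_of_mem_interior_integrableExpSet (X := id) (by simp) n

lemma iteratedDeriv_add_two_mgf_gaussianReal (m : ℝ) (v : ℝ≥0) (n : ℕ) (t : ℝ) :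
    iteratedDeriv (n + 2) (mgf id (gaussianReal m v)) t =
      (m + v * t) * iteratedDeriv (n + 1) (mgf id (gaussianReal m v)) t +
        (n + 1) * v * iteratedDeriv n (mgf id (gaussianReal m v)) t := by
  set M := mgf id (gaussianReal m v) with hM
  have hdiff (k : ℕ) (s : ℝ) : HasDerivAt (iteratedDeriv k M) (iteratedDeriv (k + 1) M s) s := by
    rw [iteratedDeriv_succ]
    exact (differentiableAt_iteratedDeriv_mgf (by simp) k).hasDerivAt
  have haff (s : ℝ) : HasDerivAt (fun s : ℝ => m + v * s) v s := by
    simpa using ((hasDerivAt_id s).const_mul (v : ℝ)).const_add m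
  have hone (s : ℝ) : iteratedDeriv 1 M s = (m + v * s) * iteratedDeriv 0 M s := by
    have : HasDerivAt M ((m + v * s) * M s) s := by
      rw [hM, mgf_id_gaussianReal]
      refine HasDerivAt.congr_deriv (((hasDerivAt_id s).const_mul m).add
        ((((hasDerivAt_id s).pow 2).const_mul (v : ℝ)).div_const 2)).exp ?_
      simp
      ring
    rw [iteratedDeriv_one, iteratedDeriv_zero, this.deriv]
  induction n generalizing t with
  | zero =>
    have := ((haff t).mul (hdiff 0 t)).congr_of_eventuallyEq (.of_forall hone)
    rw [(hdiff 1 t).unique this]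
    push_cast
    ring
  | succ n ih =>
    have := (((haff t).mul (hdiff (n + 1) t)).add
      ((hdiff n t).const_mul ((n + 1) * (v : ℝ)))).congr_of_eventuallyEq (.of_forall ih)
    rw [(hdiff (n + 2) t).unique this]
    push_cast
    ring

lemma integral_pow_add_two_gaussianReal (m : ℝ) (v : ℝ≥0) (n : ℕ) :
    ∫ x, x ^ (n + 2) ∂gaussianReal m v =
      m * ∫ x, x ^ (n + 1) ∂gaussianReal m v + (n + 1) * v * ∫ x, x ^ n ∂gaussianReal m v := by
  have h := iteratedDeriv_add_two_mgf_gaussianReal m v n 0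
  simp only [iteratedDeriv_mgf_zero (X := id) (μ := gaussianReal m v) (by simp)] at h
  simpa using h

end FreeConv

namespace PartitionWord

/-! ### Pairings and their isolated chords -/

open Classical in
/-- The pairings (perfect matchings) of `α`, encoded as the fixed-point-free involutions: `σ x` is
the point that is joined to `x` by a chord. -/
noncomputable def pairings (α : Type*) [Fintype α] : Finset (α → α) :=
  Finset.univ.filter fun σ => (∀ x, σ (σ x) = x) ∧ ∀ x, σ x ≠ x

lemma mem_pairings {α : Type*} [Fintype α] {σ : α → α} :
    σ ∈ pairings α ↔ Function.Involutive σ ∧ ∀ x, σ x ≠ x := by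
  simp [pairings, Function.Involutive]

lemma card_pairings_of_isEmpty (α : Type*) [Fintype α] [IsEmpty α] : (pairings α).card = 1 := by
  have huniv : pairings α = Finset.univ :=
    Finset.eq_univ_of_forall fun σ => mem_pairings.2 ⟨isEmptyElim, isEmptyElim⟩
  rw [huniv, Finset.card_univ, Fintype.card_unique]

lemma card_pairings_of_unique (α : Type*) [Fintype α] [Unique α] : (pairings α).card = 0 :=
  Finset.card_eq_zero.2 <| Finset.eq_empty_of_forall_notMem fun _ hσ =>
    (mem_pairings.1 hσ).2 default (Subsingleton.elim _ _)

/-- `p` is the left end of a chord of `σ` that no other chord crosses. Such chords correspond to the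
encapsulated partition subwords of a partition word. -/
def IsIsolated {α : Type*} [LT α] (σ : α → α) (p : α) : Prop :=
  p < σ p ∧ ∀ q, p < q → q < σ p → p < σ q ∧ σ q < σ p

section WeightedCount

variable {α β : Type*} [LinearOrder α] [LinearOrder β]

lemma isIsolated_conj (e : α ≃o β) (σ : α → α) (p : α) :
    IsIsolated (fun y => e (σ (e.symm y))) (e p) ↔ IsIsolated σ p := by
  simp only [IsIsolated, OrderIso.symm_apply_apply, e.lt_iff_lt]
  refine and_congr_right fun _ => ⟨fun h q hpq hq => ?_, fun h q hpq hq => ?_⟩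
  · simpa using h (e q) (by simpa using hpq) (by simpa using hq)
  · rw [← e.apply_symm_apply q, e.lt_iff_lt] at hpq hq
    simpa using h (e.symm q) hpq hq

variable [Fintype α] [Fintype β]

instance (σ : α → α) : DecidablePred (IsIsolated σ) := fun p => by
  unfold IsIsolated
  infer_instance

/-- The number of pairings of `α`, each counted with weight `2` for every isolated chord whose
left end is in `U`. -/
noncomputable def weightedCount (U : Finset α) : ℕ :=
  ∑ σ ∈ pairings α, 2 ^ (U.filter (IsIsolated σ)).card

lemma conj_mem_pairings (e : α ≃o β) {σ : α → α} (hσ : σ ∈ pairings α) :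
    (fun y => e (σ (e.symm y))) ∈ pairings β := by
  rw [mem_pairings] at hσ ⊢
  refine ⟨fun x => by simp [hσ.1 _], fun x h => hσ.2 (e.symm x) ?_⟩
  rw [← e.symm_apply_apply (σ (e.symm x)), h]

lemma weightedCount_map (e : α ≃o β) (U : Finset α) :
    weightedCount (U.map e.toEquiv.toEmbedding) = weightedCount U := by
  symm
  refine Finset.sum_nbij' (fun σ y => e (σ (e.symm y))) (fun τ x => e.symm (τ (e x)))
    (fun σ hσ => conj_mem_pairings e hσ) (fun τ hτ => conj_mem_pairings e.symm hτ)
    (fun σ _ => by ext; simp) (fun τ _ => by ext; simp) fun σ _ => ?_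
  rw [Finset.filter_map, Finset.card_map]
  congr 3
  ext p
  exact (isIsolated_conj e σ p).symm

lemma mem_iff_le_add_card_of_isUpperSet {N : ℕ} {V : Finset (Fin N)}
    (hV : IsUpperSet (V : Set (Fin N))) {i : Fin N} : i ∈ V ↔ N ≤ i + V.card := by
  refine ⟨fun hi => ?_, fun hi => ?_⟩
  · have hsub : Finset.Ici i ⊆ V := fun y hy => hV (Finset.mem_Ici.1 hy) hi
    have hle := Finset.card_le_card hsub
    rw [Fin.card_Ici] at hle
    omega
  · by_contra hiV
    have hsub : V ⊆ Finset.Ioi i := fun y hy =>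
      Finset.mem_Ioi.2 (not_le.1 fun hyi => hiV (hV hyi hy))
    have hle := Finset.card_le_card hsub
    rw [Fin.card_Ioi] at hle
    omega

/-- The weighted number of pairings of `b + n` points in which only the isolated chords with
left end among the last `n` points have weight `2`. It interpolates between the `b`-th moment of the
standard normal law (`n = 0`) and the sum over the partition words of length `n` (`b = 0`). -/
noncomputable def count (b n : ℕ) : ℕ :=
  weightedCount (Finset.univ.filter fun x : Fin (b + n) => b ≤ x.val)

lemma weightedCount_eq_count {U : Finset α} (hU : IsUpperSet (U : Set α)) {b n : ℕ}
    (hcard : Fintype.card α = b + n) (hn : U.card = n) : weightedCount U = count b n := by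
  let e : α ≃o Fin (b + n) := (Fintype.orderIsoFinOfCardEq α hcard).symm
  rw [count, ← weightedCount_map e U]
  congr 1
  have hup : IsUpperSet (U.map e.toEquiv.toEmbedding : Set (Fin (b + n))) := by
    simpa using hU.image e
  ext i
  rw [mem_iff_le_add_card_of_isUpperSet hup, Finset.card_map, hn]
  simp only [Finset.mem_filter, Finset.mem_univ, true_and]
  omega

lemma weightedCount_univ : weightedCount (Finset.univ : Finset α) = count 0 (Fintype.card α) :=
  weightedCount_eq_count (by simp [isUpperSet_univ]) (zero_add _).symm Finset.card_univ

lemma card_pairings : (pairings α).card = count (Fintype.card α) 0 := by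
  have h : weightedCount (∅ : Finset α) = count (Fintype.card α) 0 :=
    weightedCount_eq_count (by simp [isUpperSet_empty]) rfl Finset.card_empty
  simpa [weightedCount] using h

end WeightedCount

/-! ### Gluing pairings -/

section Glue

variable {α : Type*}

/-- The restriction of `σ` to a subset `P` that is stable under `σ`; points that `σ` sends out of
`P` are fixed. -/
def restrictTo (P : α → Prop) [DecidablePred P] (σ : α → α) (x : {x // P x}) : {x // P x} :=
  if h : P (σ x) then ⟨σ x, h⟩ else x

lemma coe_restrictTo {P : α → Prop} [DecidablePred P] {σ : α → α} (hP : ∀ x, P x → P (σ x))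
    (x : {x // P x}) : (restrictTo P σ x : α) = σ x := by
  simp [restrictTo, hP x x.2]

lemma restrictTo_mem_pairings [Fintype α] {P : α → Prop} [DecidablePred P] {σ : α → α}
    (hσ : σ ∈ pairings α) (hP : ∀ x, P x → P (σ x)) : restrictTo P σ ∈ pairings {x // P x} := by
  rw [mem_pairings] at hσ ⊢
  refine ⟨fun x => Subtype.ext ?_, fun x hx => hσ.2 x ?_⟩
  · rw [coe_restrictTo hP, coe_restrictTo hP, hσ.1]
  · rw [← coe_restrictTo hP, hx]

/-- The points that are neither in `P` nor one of `p`, `j`. -/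
def Outside (P : α → Prop) (p j x : α) : Prop := ¬P x ∧ x ≠ p ∧ x ≠ j

lemma mem_or_outside_or_eq (P : α → Prop) (p j x : α) :
    P x ∨ Outside P p j x ∨ x = p ∨ x = j := by
  unfold Outside
  tauto

lemma outside_apply {P : α → Prop} {σ : α → α} {p j x : α} (hσ : Function.Involutive σ)
    (hpj : σ p = j) (hP : ∀ x, P x → P (σ x)) (hx : Outside P p j x) : Outside P p j (σ x) :=
  ⟨fun h => hx.1 (hσ x ▸ hP _ h), fun h => hx.2.2 (by rw [← hpj, ← h, hσ x]),
    fun h => hx.2.1 (hσ.injective (h.trans hpj.symm))⟩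

variable [DecidableEq α] {P : α → Prop} [DecidablePred P] {p j : α}

instance (P : α → Prop) [DecidablePred P] (p j : α) : DecidablePred (Outside P p j) := fun x => by
  unfold Outside
  infer_instance

/-- The pairing that consists of a pairing of `P`, of the chord `{p, j}` and of a pairing of the
remaining points. -/
def glue (P : α → Prop) [DecidablePred P] (p j : α) (τ : {x // P x} → {x // P x})
    (υ : {x // Outside P p j x} → {x // Outside P p j x}) (x : α) : α :=
  if h : P x then τ ⟨x, h⟩ else if h' : Outside P p j x then υ ⟨x, h'⟩ else if x = p then j else p

variable {τ : {x // P x} → {x // P x}} {υ : {x // Outside P p j x} → {x // Outside P p j x}}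

lemma glue_of_mem {x : α} (h : P x) : glue P p j τ υ x = τ ⟨x, h⟩ := by
  simp [glue, h]

lemma glue_of_outside {x : α} (h : Outside P p j x) : glue P p j τ υ x = υ ⟨x, h⟩ := by
  rw [glue, dif_neg h.1, dif_pos h]

lemma glue_left (hp : ¬P p) : glue P p j τ υ p = j := by
  rw [glue, dif_neg hp, dif_neg (fun h => h.2.1 rfl), if_pos rfl]

lemma glue_right (hj : ¬P j) (hpj : p ≠ j) : glue P p j τ υ j = p := by
  rw [glue, dif_neg hj, dif_neg (fun h => h.2.2 rfl), if_neg hpj.symm]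

lemma restrictTo_glue : restrictTo P (glue P p j τ υ) = τ := by
  have hP : ∀ x, P x → P (glue P p j τ υ x) := fun x hx => by
    rw [glue_of_mem hx]
    exact (τ ⟨x, hx⟩).2
  exact funext fun x => Subtype.ext (by rw [coe_restrictTo hP, glue_of_mem x.2])

lemma restrictTo_outside_glue : restrictTo (Outside P p j) (glue P p j τ υ) = υ := by
  have hP : ∀ x, Outside P p j x → Outside P p j (glue P p j τ υ x) := fun x hx => by
    rw [glue_of_outside hx]
    exact (υ ⟨x, hx⟩).2
  exact funext fun x => Subtype.ext (by rw [coe_restrictTo hP, glue_of_outside x.2])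

variable {σ : α → α}

lemma glue_restrictTo (hp : ¬P p) (hj : ¬P j) (hne : p ≠ j) (hσ : Function.Involutive σ)
    (hpj : σ p = j) (hP : ∀ x, P x → P (σ x)) :
    glue P p j (restrictTo P σ) (restrictTo (Outside P p j) σ) = σ := by
  funext x
  rcases mem_or_outside_or_eq P p j x with h | h | rfl | rfl
  · rw [glue_of_mem h, coe_restrictTo hP]
  · rw [glue_of_outside h, coe_restrictTo fun x hx => outside_apply hσ hpj hP hx]
  · rw [glue_left hp, hpj]
  · rw [glue_right hj hne, ← hpj, hσ]

variable [Fintype α]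

lemma glue_mem_pairings (hp : ¬P p) (hj : ¬P j) (hpj : p ≠ j) (hτ : τ ∈ pairings {x // P x})
    (hυ : υ ∈ pairings {x // Outside P p j x}) : glue P p j τ υ ∈ pairings α := by
  rw [mem_pairings] at hτ hυ ⊢
  constructor
  · intro x
    rcases mem_or_outside_or_eq P p j x with h | h | rfl | rfl
    · rw [glue_of_mem h, glue_of_mem (τ ⟨x, h⟩).2, hτ.1]
    · rw [glue_of_outside h, glue_of_outside (υ ⟨x, h⟩).2, hυ.1]
    · rw [glue_left hp, glue_right hj hpj]
    · rw [glue_right hj hpj, glue_left hp]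
  · intro x
    rcases mem_or_outside_or_eq P p j x with h | h | rfl | rfl
    · rw [glue_of_mem h]
      exact fun h' => hτ.2 _ (Subtype.ext h')
    · rw [glue_of_outside h]
      exact fun h' => hυ.2 _ (Subtype.ext h')
    · rw [glue_left hp]
      exact hpj.symm
    · rw [glue_right hj hpj]
      exact hpj

lemma sum_pairings_eq_mul {R : Type*} [CommSemiring R] (hp : ¬P p) (hj : ¬P j) (hpj : p ≠ j)
    (f : (α → α) → R) (f₁ : ({x // P x} → {x // P x}) → R)
    (f₂ : ({x // Outside P p j x} → {x // Outside P p j x}) → R)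
    (hf : ∀ τ υ, f (glue P p j τ υ) = f₁ τ * f₂ υ) :
    ∑ σ ∈ pairings α with σ p = j ∧ ∀ x, P x → P (σ x), f σ =
      (∑ τ ∈ pairings {x // P x}, f₁ τ) * ∑ υ ∈ pairings {x // Outside P p j x}, f₂ υ := by
  rw [Finset.sum_mul_sum, ← Finset.sum_product']
  symm
  refine Finset.sum_nbij' (fun q => glue P p j q.1 q.2)
    (fun σ => (restrictTo P σ, restrictTo (Outside P p j) σ)) ?_ ?_ ?_ ?_ ?_
  · rintro ⟨τ, υ⟩ h
    rw [Finset.mem_product] at h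
    refine Finset.mem_filter.2 ⟨glue_mem_pairings hp hj hpj h.1 h.2, glue_left hp, fun x hx => ?_⟩
    simp only [glue_of_mem hx]
    exact (τ ⟨x, hx⟩).2
  · intro σ h
    obtain ⟨hσ, hσp, hP⟩ := Finset.mem_filter.1 h
    exact Finset.mem_product.2 ⟨restrictTo_mem_pairings hσ hP,
      restrictTo_mem_pairings hσ fun x hx => outside_apply (mem_pairings.1 hσ).1 hσp hP hx⟩
  · rintro ⟨τ, υ⟩ -
    exact Prod.ext restrictTo_glue restrictTo_outside_glue
  · intro σ h
    obtain ⟨hσ, hσp, hP⟩ := Finset.mem_filter.1 h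
    exact glue_restrictTo hp hj hpj (mem_pairings.1 hσ).1 hσp hP
  · rintro ⟨τ, υ⟩ -
    exact (hf τ υ).symm

lemma card_filter_pairings_apply_eq (hpj : p ≠ j) :
    ((pairings α).filter fun σ => σ p = j).card =
      (pairings {x // Outside (fun _ => False) p j x}).card := by
  have h := sum_pairings_eq_mul (α := α) (P := fun _ => False) (p := p) (j := j)
    not_false not_false hpj (fun _ => (1 : ℕ)) (fun _ => 1) (fun _ => 1) (fun _ _ => rfl)
  simpa [card_pairings_of_isEmpty] using h

lemma card_outside_false (hpj : p ≠ j) :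
    Fintype.card {x // Outside (fun _ => False) p j x} = Fintype.card α - 2 := by
  have hcompl : Finset.univ.filter (Outside (fun _ => False) p j) = {p, j}ᶜ := by
    ext x
    simp [Outside]
  rw [Fintype.card_subtype, hcompl, Finset.card_compl, Finset.card_pair hpj]

end Glue

/-! ### Recursions for the weighted count -/

section Between

variable {α : Type*} [LinearOrder α] {p j : α}

/-- `x` lies strictly between `p` and `j`. -/
def Between (p j x : α) : Prop := p < x ∧ x < j

instance (p j : α) : DecidablePred (Between p j) := fun x => by
  unfold Between
  infer_instance

variable {τ : {x // Between p j x} → {x // Between p j x}}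
  {υ : {x // Outside (Between p j) p j x} → {x // Outside (Between p j) p j x}}

lemma not_between_left (p j : α) : ¬Between p j p := fun h => lt_irrefl _ h.1

lemma not_between_right (p j : α) : ¬Between p j j := fun h => lt_irrefl _ h.2

lemma outside_between_iff (hpj : p < j) (x : α) : Outside (Between p j) p j x ↔ x < p ∨ j < x := by
  unfold Outside Between
  grind

lemma isIsolated_glue_of_between (x : {x // Between p j x}) :
    IsIsolated (glue (Between p j) p j τ υ) x ↔ IsIsolated τ x := by
  rw [IsIsolated, IsIsolated, glue_of_mem x.2]
  refine and_congr_right fun _ => ⟨fun h q hxq hq => ?_, fun h q hxq hq => ?_⟩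
  · have := h q hxq hq
    rwa [glue_of_mem q.2] at this
  · have hbetween : Between p j q := ⟨x.2.1.trans hxq, hq.trans (τ x).2.2⟩
    rw [glue_of_mem hbetween]
    exact h ⟨q, hbetween⟩ hxq hq

lemma glue_mem_Icc (hpj : p < j) {q : α} (hq : q ∈ Set.Icc p j) :
    glue (Between p j) p j τ υ q ∈ Set.Icc p j := by
  rcases mem_or_outside_or_eq (Between p j) p j q with h | h | rfl | rfl
  · rw [glue_of_mem h]
    exact ⟨(τ ⟨q, h⟩).2.1.le, (τ ⟨q, h⟩).2.2.le⟩
  · exact ((outside_between_iff hpj q).1 h).elim (fun h' => absurd h' hq.1.not_gt)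
      fun h' => absurd h' hq.2.not_gt
  · rw [glue_left (not_between_left _ _)]
    exact Set.right_mem_Icc.2 hpj.le
  · rw [glue_right (not_between_right _ _) hpj.ne]
    exact Set.left_mem_Icc.2 hpj.le

lemma isIsolated_glue_of_outside (hpj : p < j) (x : {x // Outside (Between p j) p j x}) :
    IsIsolated (glue (Between p j) p j τ υ) x ↔ IsIsolated υ x := by
  rw [IsIsolated, IsIsolated, glue_of_outside x.2]
  refine and_congr_right fun _ => ⟨fun h q hxq hq => ?_, fun h q hxq hq => ?_⟩
  · have := h q hxq hq
    rwa [glue_of_outside q.2] at this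
  · by_cases hout : Outside (Between p j) p j q
    · rw [glue_of_outside hout]
      exact h ⟨q, hout⟩ hxq hq
    · have hmem : q ∈ Set.Icc p j := by
        rwa [outside_between_iff hpj, not_or, not_lt, not_lt] at hout
      have hx : (x : α) < p := ((outside_between_iff hpj _).1 x.2).resolve_right
        fun h' => (h'.trans hxq).not_ge hmem.2
      have hυx : j < (υ x : α) := ((outside_between_iff hpj _).1 (υ x).2).resolve_left
        fun h' => (hq.trans h').not_ge hmem.1
      have hglue := glue_mem_Icc (τ := τ) (υ := υ) hpj hmem
      exact ⟨hx.trans_le hglue.1, hglue.2.trans_lt hυx⟩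

variable [Fintype α]

lemma card_filter_isIsolated_glue (hpj : p < j) :
    ((Finset.univ.filter (p < ·)).filter (IsIsolated (glue (Between p j) p j τ υ))).card =
      (Finset.univ.filter (IsIsolated τ)).card +
        ((Finset.univ.filter fun x : {x // Outside (Between p j) p j x} => p < x.1).filter
          (IsIsolated υ)).card := by
  rw [← Finset.card_map (Function.Embedding.subtype (Between p j)),
    ← Finset.card_map (Function.Embedding.subtype (Outside (Between p j) p j)),
    ← Finset.card_union_of_disjoint]
  · congr 1
    ext x
    simp only [Finset.mem_filter, Finset.mem_univ, true_and, Finset.mem_union, Finset.mem_map,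
      Function.Embedding.subtype_apply]
    constructor
    · rintro ⟨hpx, hx⟩
      rcases mem_or_outside_or_eq (Between p j) p j x with h | h | rfl | rfl
      · exact Or.inl ⟨⟨x, h⟩, (isIsolated_glue_of_between ⟨x, h⟩).1 hx, rfl⟩
      · exact Or.inr ⟨⟨x, h⟩, ⟨hpx, (isIsolated_glue_of_outside hpj ⟨x, h⟩).1 hx⟩, rfl⟩
      · exact absurd hpx (lt_irrefl _)
      · have hxp := hx.1
        rw [glue_right (not_between_right _ _) hpj.ne] at hxp
        exact absurd hxp hpj.not_gt
    · rintro (⟨y, hy, rfl⟩ | ⟨y, hy, rfl⟩)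
      · exact ⟨y.2.1, (isIsolated_glue_of_between y).2 hy⟩
      · exact ⟨hy.1, (isIsolated_glue_of_outside hpj y).2 hy.2⟩
  · rw [Finset.disjoint_left]
    rintro x hx hx'
    obtain ⟨y, -, rfl⟩ := Finset.mem_map.1 hx
    obtain ⟨z, -, hzy⟩ := Finset.mem_map.1 hx'
    have hzy : (z : α) = y := hzy
    exact z.2.1 (hzy ▸ y.2)

lemma sum_filter_isIsolated_pairings (p : α) :
    ∑ σ ∈ pairings α with IsIsolated σ p,
        2 ^ ((Finset.univ.filter (p < ·)).filter (IsIsolated σ)).card =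
      ∑ j ∈ Finset.univ.filter (p < ·),
        weightedCount (Finset.univ : Finset {x // Between p j x}) *
          weightedCount
            (Finset.univ.filter fun x : {x // Outside (Between p j) p j x} => p < x.1) := by
  rw [← Finset.sum_fiberwise_of_maps_to (g := fun σ : α → α => σ p)
    (t := Finset.univ.filter (p < ·))
    fun σ hσ => Finset.mem_filter.2 ⟨Finset.mem_univ _, (Finset.mem_filter.1 hσ).2.1⟩]
  refine Finset.sum_congr rfl fun j hj => ?_
  have hpj : p < j := (Finset.mem_filter.1 hj).2
  rw [weightedCount, weightedCount, ← sum_pairings_eq_mul (not_between_left p j)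
    (not_between_right p j) hpj.ne
    (fun σ => 2 ^ ((Finset.univ.filter (p < ·)).filter (IsIsolated σ)).card)
    _ _ fun τ υ => by rw [card_filter_isIsolated_glue hpj, pow_add]]
  refine Finset.sum_congr ?_ fun _ _ => rfl
  ext σ
  simp only [Finset.mem_filter, and_assoc]
  refine and_congr_right fun _ => ⟨?_, ?_⟩
  · rintro ⟨hiso, rfl⟩
    exact ⟨rfl, fun x hx => hiso.2 x hx.1 hx.2⟩
  · rintro ⟨rfl, hstable⟩
    exact ⟨⟨hpj, fun q hpq hq => hstable q ⟨hpq, hq⟩⟩, rfl⟩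

lemma weightedCount_filter_le (p : α) :
    weightedCount (Finset.univ.filter (p ≤ ·)) = weightedCount (Finset.univ.filter (p < ·)) +
      ∑ σ ∈ pairings α with IsIsolated σ p,
        2 ^ ((Finset.univ.filter (p < ·)).filter (IsIsolated σ)).card := by
  rw [weightedCount, weightedCount, Finset.sum_filter, ← Finset.sum_add_distrib]
  refine Finset.sum_congr rfl fun σ _ => ?_
  have hinsert : Finset.univ.filter (p ≤ ·) = insert p (Finset.univ.filter (p < ·)) := by
    ext x
    simp [le_iff_eq_or_lt, eq_comm]
  rw [hinsert, Finset.filter_insert]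
  split_ifs with h
  · rw [Finset.card_insert_of_notMem (by simp), pow_succ, mul_two]
  · rw [add_zero]

end Between

section Fin

variable {N : ℕ} {p j : Fin N}

lemma weightedCount_filter_lt (p : Fin N) :
    weightedCount (Finset.univ.filter (p < ·)) = count (p + 1) (N - 1 - p) := by
  refine weightedCount_eq_count (fun x y hxy hx => ?_) ?_ ?_
  · simp only [Finset.coe_filter, Finset.mem_univ, true_and, Set.mem_ofPred_eq] at hx ⊢
    exact hx.trans_le hxy
  · rw [Fintype.card_fin]
    omega
  · rw [Finset.filter_lt_eq_Ioi, Fin.card_Ioi]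

lemma weightedCount_between (p j : Fin N) :
    weightedCount (Finset.univ : Finset {x // Between p j x}) = count 0 (j - p - 1) := by
  have hIoo : Finset.univ.filter (Between p j) = Finset.Ioo p j := by
    ext x
    simp [Between]
  rw [weightedCount_univ, Fintype.card_subtype, hIoo, Fin.card_Ioo]

lemma weightedCount_outside_between (hpj : p < j) :
    weightedCount (Finset.univ.filter fun x : {x // Outside (Between p j) p j x} => p < x.1) =
      count p (N - 1 - j) := by
  refine weightedCount_eq_count (fun x y hxy hx => ?_) ?_ ?_
  · simp only [Finset.coe_filter, Finset.mem_univ, true_and, Set.mem_ofPred_eq] at hx ⊢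
    exact hx.trans_le hxy
  · have hIcc : Finset.univ.filter (Outside (Between p j) p j) = (Finset.Icc p j)ᶜ := by
      ext x
      simp only [Finset.mem_filter, Finset.mem_univ, true_and, outside_between_iff hpj,
        Finset.mem_compl, Finset.mem_Icc, not_and_or, not_le]
    rw [Fintype.card_subtype, hIcc, Finset.card_compl, Fin.card_Icc, Fintype.card_fin]
    omega
  · have hIoi : (Finset.univ.filter fun x : {x // Outside (Between p j) p j x} => p < x.1).map
        (Function.Embedding.subtype (Outside (Between p j) p j)) = Finset.Ioi j := by
      ext x
      rw [Finset.mem_map, Finset.mem_Ioi]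
      constructor
      · rintro ⟨y, hy, rfl⟩
        exact ((outside_between_iff hpj _).1 y.2).resolve_left (Finset.mem_filter.1 hy).2.not_gt
      · intro hjx
        exact ⟨⟨x, (outside_between_iff hpj x).2 (Or.inr hjx)⟩,
          Finset.mem_filter.2 ⟨Finset.mem_univ _, hpj.trans hjx⟩, rfl⟩
    rw [← Finset.card_map (Function.Embedding.subtype (Outside (Between p j) p j)), hIoi,
      Fin.card_Ioi]

end Fin

lemma count_succ (b n : ℕ) :
    count b (n + 1) = count (b + 1) n + ∑ i ∈ Finset.range n, count 0 i * count b (n - 1 - i) := by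
  let p : Fin (b + (n + 1)) := ⟨b, by omega⟩
  have hcount : count b (n + 1) = weightedCount (Finset.univ.filter (p ≤ ·)) := rfl
  have hchords : ∑ j ∈ Finset.univ.filter (p < ·),
      weightedCount (Finset.univ : Finset {x // Between p j x}) *
        weightedCount (Finset.univ.filter fun x : {x // Outside (Between p j) p j x} => p < x.1) =
      ∑ i ∈ Finset.range n, count 0 i * count b (n - 1 - i) := by
    refine Finset.sum_bij' (fun j _ => j.val - b - 1)
      (fun i hi => ⟨b + 1 + i, by have := Finset.mem_range.1 hi; omega⟩) ?_ ?_ ?_ ?_ ?_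
    · intro j hj
      have hbj : b < j.val := (Finset.mem_filter.1 hj).2
      rw [Finset.mem_range]
      omega
    · intro i _
      simp only [Finset.mem_filter, Finset.mem_univ, true_and, p, Fin.lt_def]
      omega
    · intro j hj
      have hbj : b < j.val := (Finset.mem_filter.1 hj).2
      exact Fin.ext (by simp only; omega)
    · intro i _
      simp only
      omega
    · intro j hj
      have hpj : p < j := (Finset.mem_filter.1 hj).2
      have hbj : b < j.val := hpj
      rw [weightedCount_between, weightedCount_outside_between hpj]
      congr 2
      omega
  rw [hcount, weightedCount_filter_le, sum_filter_isIsolated_pairings, hchords,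
    weightedCount_filter_lt]
  congr 2
  simp only [p]
  omega

lemma count_zero_zero : count 0 0 = 1 := by
  rw [← card_pairings_of_isEmpty (Fin 0), card_pairings, Fintype.card_fin]

lemma count_one_zero : count 1 0 = 0 := by
  have h := card_pairings_of_unique (Fin 1)
  rwa [card_pairings, Fintype.card_fin] at h

lemma count_add_two_zero (n : ℕ) : count (n + 2) 0 = (n + 1) * count n 0 := by
  have hfiber (j : Fin (n + 2)) (hj : j ∈ Finset.univ.erase 0) :
      ((pairings (Fin (n + 2))).filter fun σ => σ 0 = j).card = count n 0 := by
    have h0j : 0 ≠ j := (Finset.mem_erase.1 hj).1.symm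
    rw [card_filter_pairings_apply_eq h0j, card_pairings, card_outside_false h0j, Fintype.card_fin,
      Nat.add_sub_cancel]
  have htotal : count (n + 2) 0 = (pairings (Fin (n + 2))).card := by
    rw [card_pairings, Fintype.card_fin]
  rw [htotal, Finset.card_eq_sum_card_fiberwise (f := fun σ => σ 0) (t := Finset.univ.erase 0)
    fun σ hσ => by simpa using (mem_pairings.1 (Finset.mem_coe.1 hσ)).2 0,
    Finset.sum_congr rfl hfiber, Finset.sum_const, Finset.card_erase_of_mem (Finset.mem_univ _),
    Finset.card_univ, Fintype.card_fin, smul_eq_mul, Nat.add_succ_sub_one]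

lemma count_zero_le (n : ℕ) : count 0 n ≤ 2 ^ n * count n 0 := by
  have hweighted : weightedCount (Finset.univ : Finset (Fin n)) = count 0 n := by
    rw [weightedCount_univ, Fintype.card_fin]
  have htotal : (pairings (Fin n)).card = count n 0 := by
    rw [card_pairings, Fintype.card_fin]
  rw [← hweighted, ← htotal, mul_comm, ← smul_eq_mul]
  refine Finset.sum_le_card_nsmul _ _ _ fun σ _ => Nat.pow_le_pow_right two_pos ?_
  exact (Finset.card_filter_le _ _).trans (by simp)

/-! ### Partition words as pairings -/

section Partner

variable {ι κ : Type*} [Fintype ι] [DecidableEq κ] {w : ι → κ}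

/-- Every letter that occurs in the word `w` occurs exactly twice. -/
def IsDoubleOccurrence (w : ι → κ) : Prop :=
  ∀ x, (Finset.univ.filter fun y => w y = w x).card = 2

open Classical in
/-- The position other than `x` that carries the letter `w x`, for a word `w` in which every letter
occurs twice; `x` itself if there is no such position. -/
noncomputable def partner {ι κ : Type*} (w : ι → κ) (x : ι) : ι :=
  if h : ∃ y, y ≠ x ∧ w y = w x then h.choose else x

lemma IsDoubleOccurrence.partner_eq (hw : IsDoubleOccurrence w) {x y : ι} (hyx : y ≠ x)
    (hwyx : w y = w x) : partner w x = y := by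
  have hex : ∃ y, y ≠ x ∧ w y = w x := ⟨y, hyx, hwyx⟩
  rw [partner, dif_pos hex]
  by_contra hne
  have hthree : 2 < (Finset.univ.filter fun z => w z = w x).card :=
    Finset.two_lt_card.2 ⟨hex.choose, by simpa using hex.choose_spec.2, y, by simpa using hwyx, x,
      by simp, hne, hex.choose_spec.1, hyx⟩
  exact hthree.ne' (hw x)

lemma IsDoubleOccurrence.partner_ne_and_apply_partner (hw : IsDoubleOccurrence w) (x : ι) :
    partner w x ≠ x ∧ w (partner w x) = w x := by
  have hcard : 1 < (Finset.univ.filter fun y => w y = w x).card := by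
    rw [hw x]
    exact one_lt_two
  obtain ⟨y, hy, hyx⟩ := Finset.exists_mem_ne hcard x
  have hwyx : w y = w x := (Finset.mem_filter.1 hy).2
  rw [hw.partner_eq hyx hwyx]
  exact ⟨hyx, hwyx⟩

lemma IsDoubleOccurrence.partner_ne (hw : IsDoubleOccurrence w) (x : ι) : partner w x ≠ x :=
  (hw.partner_ne_and_apply_partner x).1

lemma IsDoubleOccurrence.apply_partner (hw : IsDoubleOccurrence w) (x : ι) :
    w (partner w x) = w x :=
  (hw.partner_ne_and_apply_partner x).2

lemma IsDoubleOccurrence.apply_eq_iff (hw : IsDoubleOccurrence w) {x y : ι} :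
    w y = w x ↔ y = x ∨ y = partner w x := by
  refine ⟨fun h => or_iff_not_imp_left.2 fun hyx => (hw.partner_eq hyx h).symm, ?_⟩
  rintro (rfl | rfl)
  exacts [rfl, hw.apply_partner x]

lemma IsDoubleOccurrence.partner_mem_pairings (hw : IsDoubleOccurrence w) :
    partner w ∈ pairings ι :=
  mem_pairings.2 ⟨fun x => hw.partner_eq (hw.partner_ne x).symm (hw.apply_partner x).symm,
    hw.partner_ne⟩

lemma IsDoubleOccurrence.card_eq (hw : IsDoubleOccurrence w) :
    Fintype.card ι = 2 * (Finset.univ.image w).card := by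
  have hfiber : ∀ a ∈ Finset.univ.image w, (Finset.univ.filter fun x => w x = a).card = 2 := by
    intro a ha
    obtain ⟨x, -, rfl⟩ := Finset.mem_image.1 ha
    exact hw x
  rw [← Finset.card_univ, Finset.card_eq_sum_card_image w, Finset.sum_congr rfl hfiber,
    Finset.sum_const, smul_eq_mul, mul_comm]

lemma IsDoubleOccurrence.surjective [Fintype κ] (hw : IsDoubleOccurrence w)
    (hcard : Fintype.card ι = 2 * Fintype.card κ) : Function.Surjective w := by
  have himage : (Finset.univ.image w).card = Fintype.card κ :=
    Nat.eq_of_mul_eq_mul_left two_pos (hw.card_eq.symm.trans hcard)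
  intro a
  have ha : a ∈ Finset.univ.image w := Finset.eq_univ_of_card _ himage ▸ Finset.mem_univ a
  simpa using ha

end Partner

section Height

variable {n k : ℕ} {w : Fin n → Fin k}

lemma IsPartitionOn.isDoubleOccurrence (hw : IsPartitionOn w Finset.univ) :
    IsDoubleOccurrence w :=
  fun x => hw.1 x (Finset.mem_univ x)

lemma IsPartitionOn.exists_lt (hw : IsPartitionOn w Finset.univ) {x y : Fin n} (h : w x < w y) :
    ∃ x' < y, w x' = w x := by
  obtain ⟨x', -, hx'⟩ := hw.2 x (Finset.mem_univ x) y (Finset.mem_univ y) h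
  exact ⟨x', hx'⟩

lemma IsPartitionOn.isPartitionOn_Ioo_iff (hw : IsPartitionOn w Finset.univ) {p q : Fin n} :
    IsPartitionOn w (Finset.Ioo p q) ↔
      ∀ r, p < r → r < q → p < partner w r ∧ partner w r < q := by
  have hdouble := hw.isDoubleOccurrence
  constructor
  · intro h r hpr hrq
    have hfilter : (Finset.Ioo p q).filter (fun m => w m = w r) =
        Finset.univ.filter fun m => w m = w r :=
      Finset.eq_of_subset_of_card_le (Finset.filter_subset_filter _ (Finset.subset_univ _))
        (by rw [h.1 r (Finset.mem_Ioo.2 ⟨hpr, hrq⟩), hdouble r])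
    have hmem : partner w r ∈ (Finset.Ioo p q).filter (fun m => w m = w r) := by
      rw [hfilter, Finset.mem_filter]
      exact ⟨Finset.mem_univ _, hdouble.apply_partner r⟩
    exact Finset.mem_Ioo.1 (Finset.mem_filter.1 hmem).1
  · intro h
    have hclosed : ∀ l ∈ Finset.Ioo p q, ∀ m, w m = w l → m ∈ Finset.Ioo p q := by
      intro l hl m hm
      rcases hdouble.apply_eq_iff.1 hm with rfl | rfl
      · exact hl
      · exact Finset.mem_Ioo.2 (h l (Finset.mem_Ioo.1 hl).1 (Finset.mem_Ioo.1 hl).2)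
    refine ⟨fun l hl => ?_, fun l hl m _ hlm => ?_⟩
    · rw [← hdouble l]
      congr 1
      ext m
      simp only [Finset.mem_filter, Finset.mem_univ, true_and, and_iff_right_iff_imp]
      exact hclosed l hl m
    · obtain ⟨l', hl'm, hl'⟩ := hw.exists_lt hlm
      exact ⟨l', hclosed l hl l' hl', hl'm, hl'⟩

lemma IsPartitionOn.height_eq (hw : IsPartitionOn w Finset.univ) :
    height w = (Finset.univ.filter (IsIsolated (partner w))).card := by
  have hdouble := hw.isDoubleOccurrence
  have hpartner {x y : Fin n} (hxy : x < y) (h : w x = w y) : partner w x = y :=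
    hdouble.partner_eq hxy.ne' h.symm
  refine Finset.card_nbij' Prod.fst (fun x => (x, partner w x)) ?_ ?_ ?_ ?_
  · rintro ⟨x, y⟩ hxy
    obtain ⟨-, hlt, hletter, hpart⟩ := Finset.mem_filter.1 hxy
    refine Finset.mem_filter.2 ⟨Finset.mem_univ _, ?_⟩
    rw [IsIsolated, hpartner hlt hletter]
    exact ⟨hlt, hw.isPartitionOn_Ioo_iff.1 hpart⟩
  · intro x hx
    obtain ⟨-, hlt, hisolated⟩ := Finset.mem_filter.1 hx
    exact Finset.mem_filter.2 ⟨Finset.mem_univ _, hlt, (hdouble.apply_partner x).symm,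
      hw.isPartitionOn_Ioo_iff.2 hisolated⟩
  · rintro ⟨x, y⟩ hxy
    obtain ⟨-, hlt, hletter, -⟩ := Finset.mem_filter.1 hxy
    exact Prod.ext rfl (hpartner hlt hletter)
  · intro x _
    rfl

end Height

section Openers

variable {α : Type*} [LinearOrder α] {σ : α → α} {x y : α}

lemma min_apply_eq_min_apply_iff (hσ : Function.Involutive σ) :
    min y (σ y) = min x (σ x) ↔ y = x ∨ y = σ x := by
  constructor
  · intro h
    rcases min_choice y (σ y) with hy | hy <;> rcases min_choice x (σ x) with hx | hx <;>
      rw [hx, hy] at h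
    · exact Or.inl h
    · exact Or.inr h
    · exact Or.inr (by rw [← h, hσ])
    · exact Or.inl (hσ.injective h)
  · rintro (rfl | rfl)
    · rfl
    · rw [hσ, min_comm]

variable [Fintype α]

lemma min_lt_apply_min (hσ : σ ∈ pairings α) (x : α) : min x (σ x) < σ (min x (σ x)) := by
  obtain ⟨hinv, hne⟩ := mem_pairings.1 hσ
  rcases lt_or_gt_of_ne (hne x) with h | h
  · rwa [min_eq_right h.le, hinv]
  · rwa [min_eq_left h.le]

/-- The left ends of the chords of `σ`. -/
def openers (σ : α → α) : Finset α := Finset.univ.filter fun y => y < σ y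

lemma mem_openers : x ∈ openers σ ↔ x < σ x := by
  simp [openers]

lemma two_mul_card_openers (hσ : σ ∈ pairings α) : 2 * (openers σ).card = Fintype.card α := by
  obtain ⟨hinv, hne⟩ := mem_pairings.1 hσ
  have hcompl : (openers σ)ᶜ.card = (openers σ).card := by
    refine Finset.card_nbij' σ σ (fun y hy => ?_) (fun y hy => ?_) (fun y _ => hinv y)
      fun y _ => hinv y
    · simp only [Finset.coe_compl, Set.mem_compl_iff, Finset.mem_coe, mem_openers, not_lt,
        hinv y] at hy ⊢
      exact lt_of_le_of_ne hy (hne y)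
    · simp only [Finset.coe_compl, Set.mem_compl_iff, Finset.mem_coe, mem_openers, not_lt,
        hinv y] at hy ⊢
      exact hy.le
  rw [← Finset.card_add_card_compl (openers σ), hcompl, two_mul]

/-- The number of chords of `σ` that start before `x`. If `x` is itself the left end of a chord,
this is the letter that a partition word with pairing `σ` carries at `x`. -/
def openersBelow (σ : α → α) (x : α) : ℕ := ((openers σ).filter (· < x)).card

lemma openersBelow_mono : Monotone (openersBelow σ) := fun _ _ h =>
  Finset.card_le_card <| Finset.monotone_filter_right _ fun _ _ hz => hz.trans_le h

lemma openersBelow_strictMonoOn : StrictMonoOn (openersBelow σ) (openers σ : Set α) := by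
  intro x hx y _ hxy
  refine Finset.card_lt_card (Finset.ssubset_iff_of_subset ?_ |>.2 ⟨x, ?_, ?_⟩)
  · exact Finset.monotone_filter_right _ fun _ _ hz => hz.trans hxy
  · exact Finset.mem_filter.2 ⟨hx, hxy⟩
  · simp

lemma openersBelow_lt_card (hx : x ∈ openers σ) : openersBelow σ x < (openers σ).card :=
  Finset.card_lt_card (Finset.filter_ssubset.2 ⟨x, hx, lt_irrefl x⟩)

end Openers

section Words

variable {k : ℕ} {w : Fin (2 * k) → Fin k}

lemma IsDoubleOccurrence.injOn_openers_partner {α κ : Type*} [LinearOrder α] [Fintype α]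
    [DecidableEq κ] {w : α → κ} (hw : IsDoubleOccurrence w) :
    Set.InjOn w (openers (partner w) : Set α) := by
  intro y hy z hz h
  have hy : y < partner w y := mem_openers.1 hy
  have hz : z < partner w z := mem_openers.1 hz
  rcases hw.apply_eq_iff.1 h with h | rfl
  · exact h
  · rw [(mem_pairings.1 hw.partner_mem_pairings).1] at hy
    exact absurd hz hy.not_gt

lemma IsPartitionOn.apply_lt_of_lt_min {n k : ℕ} {w : Fin n → Fin k}
    (hw : IsPartitionOn w Finset.univ) {x y : Fin n} (h : y < min x (partner w x)) : w y < w x := by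
  by_contra hnot
  obtain ⟨x', hx'y, hx'⟩ : ∃ x' ≤ y, w x' = w x := by
    rcases (not_lt.1 hnot).eq_or_lt with heq | hlt
    · exact ⟨y, le_rfl, heq.symm⟩
    · obtain ⟨x', hx'y, hx'⟩ := hw.exists_lt hlt
      exact ⟨x', hx'y.le, hx'⟩
  have hx'min := lt_min_iff.1 (hx'y.trans_lt h)
  rcases hw.isDoubleOccurrence.apply_eq_iff.1 hx' with rfl | rfl
  · exact lt_irrefl _ hx'min.1
  · exact lt_irrefl _ hx'min.2

lemma IsPartitionOn.val_eq_openersBelow (hw : IsPartitionOn w Finset.univ) (x : Fin (2 * k)) :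
    (w x).val = openersBelow (partner w) (min x (partner w x)) := by
  have hdouble := hw.isDoubleOccurrence
  have happly_min y : w (min y (partner w y)) = w y := by
    rcases min_choice y (partner w y) with h | h <;> rw [h]
    exact hdouble.apply_partner y
  rw [openersBelow, ← Fin.card_Iio]
  symm
  refine Finset.card_nbij w ?_ ?_ ?_
  · intro y hy
    exact Finset.mem_coe.2 (Finset.mem_Iio.2 (hw.apply_lt_of_lt_min (Finset.mem_filter.1 hy).2))
  · exact hdouble.injOn_openers_partner.mono (Finset.coe_subset.2 (Finset.filter_subset _ _))
  · intro a ha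
    obtain ⟨y, rfl⟩ := hdouble.surjective (by simp) a
    have hyx : w y < w (min x (partner w x)) := by
      rw [happly_min]
      exact Finset.mem_Iio.1 (Finset.mem_coe.1 ha)
    obtain ⟨y', hy'x, hy'⟩ := hw.exists_lt hyx
    refine ⟨min y' (partner w y'), ?_, (happly_min y').trans hy'⟩
    exact Finset.mem_coe.2 (Finset.mem_filter.2
      ⟨mem_openers.2 (min_lt_apply_min hdouble.partner_mem_pairings y'),
        (min_le_left _ _).trans_lt hy'x⟩)

/-- The word with pairing `σ` whose letters are numbered in the order of their first occurrences. -/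
def wordOfPairing {σ : Fin (2 * k) → Fin (2 * k)} (hσ : σ ∈ pairings (Fin (2 * k)))
    (x : Fin (2 * k)) : Fin k :=
  ⟨openersBelow σ (min x (σ x)), by
    have hlt := openersBelow_lt_card (mem_openers.2 (min_lt_apply_min hσ x))
    have hcard := two_mul_card_openers hσ
    rw [Fintype.card_fin] at hcard
    omega⟩

variable {σ : Fin (2 * k) → Fin (2 * k)}

lemma wordOfPairing_apply_eq_iff (hσ : σ ∈ pairings (Fin (2 * k))) {x y : Fin (2 * k)} :
    wordOfPairing hσ y = wordOfPairing hσ x ↔ y = x ∨ y = σ x := by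
  rw [← min_apply_eq_min_apply_iff (mem_pairings.1 hσ).1, Fin.ext_iff]
  exact openersBelow_strictMonoOn.injOn.eq_iff (mem_openers.2 (min_lt_apply_min hσ y))
    (mem_openers.2 (min_lt_apply_min hσ x))

lemma isDoubleOccurrence_wordOfPairing (hσ : σ ∈ pairings (Fin (2 * k))) :
    IsDoubleOccurrence (wordOfPairing hσ) := by
  intro x
  have hpair :
      (Finset.univ.filter fun y => wordOfPairing hσ y = wordOfPairing hσ x) = {x, σ x} := by
    ext y
    simp [wordOfPairing_apply_eq_iff]
  rw [hpair, Finset.card_pair ((mem_pairings.1 hσ).2 x).symm]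

lemma partner_wordOfPairing (hσ : σ ∈ pairings (Fin (2 * k))) :
    partner (wordOfPairing hσ) = σ :=
  funext fun x => (isDoubleOccurrence_wordOfPairing hσ).partner_eq ((mem_pairings.1 hσ).2 x)
    ((wordOfPairing_apply_eq_iff hσ).2 (Or.inr rfl))

lemma isPartitionOn_wordOfPairing (hσ : σ ∈ pairings (Fin (2 * k))) :
    IsPartitionOn (wordOfPairing hσ) Finset.univ := by
  refine ⟨fun x _ => isDoubleOccurrence_wordOfPairing hσ x, fun x _ y _ hxy => ?_⟩
  have hlt : openersBelow σ (min x (σ x)) < openersBelow σ (min y (σ y)) := hxy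
  refine ⟨min x (σ x), Finset.mem_univ _, ?_, ?_⟩
  · exact (openersBelow_mono.reflect_lt hlt).trans_le (min_le_left _ _)
  · exact (wordOfPairing_apply_eq_iff hσ).2 (min_choice _ _)

lemma mem_words : w ∈ words k ↔ IsPartitionOn w Finset.univ := by
  simp [words]

theorem sum_words_two_pow_height (k : ℕ) : ∑ w ∈ words k, 2 ^ height w = count 0 (2 * k) := by
  have hcount : weightedCount (Finset.univ : Finset (Fin (2 * k))) = count 0 (2 * k) := by
    rw [weightedCount_univ, Fintype.card_fin]
  rw [← hcount]
  refine Finset.sum_nbij partner ?_ ?_ ?_ ?_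
  · intro w hw
    exact (mem_words.1 hw).isDoubleOccurrence.partner_mem_pairings
  · intro w hw w' hw' h
    funext x
    rw [Fin.ext_iff, (mem_words.1 hw).val_eq_openersBelow, (mem_words.1 hw').val_eq_openersBelow, h]
  · intro σ hσ
    exact ⟨wordOfPairing hσ, mem_words.2 (isPartitionOn_wordOfPairing hσ), partner_wordOfPairing hσ⟩
  · intro w hw
    rw [(mem_words.1 hw).height_eq]

end Words

end PartitionWord

namespace FreeConv

open PartitionWord

/-! ### The free convolution of the semicircle law and the standard normal law -/

lemma count_zero_eq_integral_pow (b : ℕ) : (count b 0 : ℝ) = ∫ x, x ^ b ∂gaussianReal 0 1 := by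
  induction b using Nat.twoStepInduction with
  | zero => simp [count_zero_zero]
  | one =>
    rw [count_one_zero, integral_pow_eq_zero_of_isSymmetric (isSymmetric_gaussianReal 1) odd_one,
      Nat.cast_zero]
  | more b ih _ =>
    rw [count_add_two_zero, integral_pow_add_two_gaussianReal, ← ih]
    push_cast
    ring

lemma isPasturRecursion_count :
    IsPasturRecursion (fun b => ∫ x, x ^ b ∂gaussianReal 0 1) fun b n => (count b n : ℝ) where
  apply_zero := count_zero_eq_integral_pow
  apply_one b := by simp [count_succ b 0]
  apply_add_two b n := by
    rw [count_succ b (n + 1), Nat.add_sub_cancel]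
    push_cast
    rfl

lemma sum_words_two_pow_height_eq_count (k : ℕ) :
    ∑ w ∈ words k, (2 : ℝ) ^ height w = count 0 (2 * k) := by
  exact_mod_cast sum_words_two_pow_height k

lemma IsPasturSolution.hasHeightMoments {ρ : Measure ℝ} [IsProbabilityMeasure ρ]
    (h : IsPasturSolution (gaussianReal 0 1) ρ) : HasHeightMoments ρ := fun k => by
  rw [sum_words_two_pow_height_eq_count]
  exact h.integral_pow (integrable_pow_gaussianReal 0 1) isPasturRecursion_count (2 * k)

lemma HasHeightMoments.integrable_exp_mul {ρ : Measure ℝ} (h : HasHeightMoments ρ) (t : ℝ) :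
    Integrable (fun x => Real.exp (t * x)) ρ := by
  refine integrable_exp_mul_of_integral_pow_le (c := 2) (ν := gaussianReal 0 1) (fun k => (h k).1)
    integrable_exp_mul_gaussianReal (fun k => ?_) t
  rw [(h k).2, sum_words_two_pow_height_eq_count, ← count_zero_eq_integral_pow]
  exact_mod_cast count_zero_le (2 * k)

lemma IsSymmetric.eq_of_hasHeightMoments {μ ν : Measure ℝ} [IsFiniteMeasure μ] [IsFiniteMeasure ν]
    (hμ : IsSymmetric μ) (hν : IsSymmetric ν) (hμ' : HasHeightMoments μ)
    (hν' : HasHeightMoments ν) : μ = ν :=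
  hμ.ext_of_integral_pow_eq hν hν'.integrable_exp_mul (fun k => (hμ' k).1)
    fun k => (hμ' k).2.trans (hν' k).2.symm

end FreeConv

theorem propositionA5 :
    ∃ γ : ProbabilityMeasure ℝ,
      (∀ ρ : ProbabilityMeasure ℝ,
        FreeConv.IsFreeConvolution FreeConv.semicircle (gaussianReal 0 1) (ρ : Measure ℝ) ↔
          ρ = γ) ∧
      (∀ ρ : ProbabilityMeasure ℝ,
        (FreeConv.IsSymmetric (ρ : Measure ℝ) ∧ FreeConv.HasHeightMoments (ρ : Measure ℝ)) ↔
          ρ = γ) := by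
  obtain ⟨γ, hγ, h⟩ := FreeConv.exists_isPasturSolution (gaussianReal 0 1)
  have hsymm : FreeConv.IsSymmetric γ := h.isSymmetric (FreeConv.isSymmetric_gaussianReal 1)
  have hmom : FreeConv.HasHeightMoments γ := h.hasHeightMoments
  have hconv : FreeConv.IsFreeConvolution FreeConv.semicircle (gaussianReal 0 1) γ :=
    h.isFreeConvolution_semicircle (memLp_id_gaussianReal 2)
  refine ⟨⟨γ, hγ⟩, fun ρ => ⟨fun hρ => ?_, ?_⟩, fun ρ => ⟨fun hρ => ?_, ?_⟩⟩
  · have hρ_prob : IsProbabilityMeasure ρ.1 := ρ.2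
    exact Subtype.ext (h.eq_of_isFreeConvolution_semicircle hρ)
  · rintro rfl
    exact hconv
  · exact Subtype.ext (hρ.1.eq_of_hasHeightMoments hsymm hρ.2 hmom)
  · rintro rfl
    exact ⟨hsymm, hmom⟩
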